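/- **Setting.** Let $\mathcal F$ be a signature and $\mathcal V$ an infinite set of variables; terms are elements of $\mathcal T(\mathcal F,\mathcal V)$. Equations $s\approx t$ and rules $s\to t$ are ordered pairs of terms. For a set $A$ of such pairs, $\to_A$ is its closure under contexts and substitutions, $\leftrightarrow_A$ and $\leftrightarrow_A^*$ are the symmetric and the reflexive-symmetric-transitive closure of $\to_A$, $s\downarrow_A t$ means $s\to_A^*\cdot\,{}_A^{*}\!\leftarrow t$, and $A^{\pm}=A\cup A^{-1}$. $A$ is *ground-complete* if $\to_A$ is well-founded and any ground terms $s,t$ with $s\;{}_A^{*}\!\leftarrow\cdot\to_A^* t$ satisfy $s\downarrow_A t$. Write $s\trianglerighteq t$ if $s=C[t\sigma]$ for some context $C$ and substitution $\sigma$, and $s\vartriangleright t$ if $s\trianglerighteq t$ but not $t\trianglerighteq s$. Let $>$ be a ground-total reduction order: a well-founded strict order on terms, closed under contexts and substitutions, such that $s>t$, $t>s$ or $s=t$ for all ground terms $s,t$. Put $\mathcal E^{>}=\{\ell\sigma\to r\sigma \mid \ell\approx r\in\mathcal E^{\pm},\ \ell\sigma>r\sigma\}$. Write $t\to^{\vartriangleright}_{\mathcal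 E^>}u$ if $t=C[\ell\sigma]$, $u=C[r\sigma]$, $\ell\sigma>r\sigma$ and $t\vartriangleright \ell$ for some $\ell\approx r\in\mathcal E^{\pm}$, $C$, $\sigma$; and $t\to^{\vartriangleright}_{\mathcal R}u$ if $t=C[\ell\sigma]$, $u=C[r\sigma]$ and $t\vartriangleright\ell$ for some $\ell\to r\in\mathcal R$, $C$, $\sigma$. **Ordered completion.** $(\mathcal E,\mathcal R)\vdash(\mathcal E',\mathcal R')$ holds if it is an instance of one of the following inferences ($\uplus$ denotes disjoint union): - *deduce*: $(\mathcal E,\mathcal R)\vdash(\mathcal E\cup\{s\approx t\},\mathcal R)$ if $c\to_{\mathcal R\cup\mathcal E^\pm}s$ and $c\to_{\mathcal R\cup\mathcal E^\pm}t$ for some term $c$; - *orient*: $(\mathcal E\uplus\{s\approx t\},\mathcal R)\vdash(\mathcal E,\mathcal R\cup\{s\to t\})$ if $s>t$, and $(\mathcal E\uplus\{s\approx t\},\mathcal R)\vdash(\mathcal E,\mathcal R\cup\{t\to s\})$ if $t>s$; - *delete*: $(\mathcal E\uplus\{s\approx s\},\mathcal R)\vdash(\mathcal E,\mathcal R)$;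 - *compose*: $(\mathcal E,\mathcal R\uplus\{s\to t\})\vdash(\mathcal E,\mathcal R\cup\{s\to u\})$ if $t\to_{\mathcal E^>\cup\mathcal R}u$; - *simplify*: $(\mathcal E\uplus\{s\approx t\},\mathcal R)\vdash(\mathcal E\cup\{u\approx t\},\mathcal R)$ if $s\to_{\mathcal R}u$ or $s\to^{\vartriangleright}_{\mathcal E^>}u$, and $(\mathcal E\uplus\{s\approx t\},\mathcal R)\vdash(\mathcal E\cup\{s\approx u\},\mathcal R)$ if $t\to_{\mathcal R}u$ or $t\to^{\vartriangleright}_{\mathcal E^>}u$; - *collapse*: $(\mathcal E,\mathcal R\uplus\{t\to s\})\vdash(\mathcal E\cup\{u\approx s\},\mathcal R)$ if $t\to^{\vartriangleright}_{\mathcal R}u$ or $t\to^{\vartriangleright}_{\mathcal E^>}u$. A *run* is a finite or infinite sequence $(\mathcal E_0,\mathcal R_0)\vdash(\mathcal E_1,\mathcal R_1)\vdash\cdots$ with $\mathcal R_0=\varnothing$ (a finite run is continued by repeating its last pair forever). Put $\mathcal E_\infty=\bigcup_i\mathcal E_i$, $\mathcal E_\omega=\bigcup_i\bigcap_{j\ge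 i}\mathcal E_j$, $\mathcal R_\omega=\bigcup_i\bigcap_{j\ge i}\mathcal R_j$ and $\mathcal S_\omega=\mathcal E_\omega^{>}\cup\mathcal R_\omega$. **Fairness.** For a set $\mathcal E$ of equations, $\mathrm{PCP}_>(\mathcal E)$ is the set of all pairs $\ell_2[r_1]_p\mu\approx r_2\mu$ such that $\ell_1\approx r_1$ and $\ell_2\approx r_2$ are variants (under renamings) of equations in $\mathcal E^{\pm}$ without common variables, $p$ is a function symbol position of $\ell_2$, $\mu$ is a most general unifier of $\ell_1$ and $\ell_2|_p$, neither $r_1\mu>\ell_1\mu$ nor $r_2\mu>\ell_2\mu$ holds, and all proper subterms of $\ell_1\mu$ are normal forms of $\to_{\mathcal E^>}$. A run is *fair* if every $s\approx t$ in $\mathrm{PCP}_>(\mathcal E_\omega\cup\mathcal R_\omega)$ satisfies $s\downarrow_{\mathcal S_\omega}t$ or $s\leftrightarrow_{\mathcal E_\infty}t$. **Theorem.** For every fair run, $\mathcal S_\omega$ is ground-complete, and the relations $\leftrightarrow^*_{\mathcal E_0}$ and $\leftrightarrow^*_{\mathcal E_\omega\cup\mathcal R_\omega}$ on $\mathcal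 T(\mathcal F,\mathcal V)$ coincide. -/

import Mathlib

universe u v w

namespace OrderedCompletion

/- Terms over a signature and a set `V` of variables are Mathlib's first-order terms `L.Term V`;
`L.Functions n` is the set of function symbols of arity `n` (relation symbols play no role).
Substitutions are maps `V → L.Term V`, applied with `Term.subst`. Equations and rewrite rules are
ordered pairs of terms. -/

variable {L : FirstOrder.Language.{u, v}} {V : Type w}

/-- The set of variables occurring in a term. -/
def vars (t : L.Term V) : Set V :=
  open Classical in {x | x ∈ t.varFinset}

/-- Ground terms: terms without variables. -/
def IsGround (t : L.Term V) : Prop := vars t = ∅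

/-- The term is a variable. -/
def IsVar (t : L.Term V) : Prop := ∃ x : V, t = FirstOrder.Language.Term.var x

/-- Contexts, i.e. terms with one hole. In `app f ts i C` the argument at index `i` is the
context `C` (the value `ts i` is ignored), the other arguments are given by `ts`. -/
inductive Ctx (L : FirstOrder.Language.{u, v}) (V : Type w) : Type (max u w)
  | hole : Ctx L V
  | app {n : ℕ} (f : L.Functions n) (ts : Fin n → L.Term V) (i : Fin n) (C : Ctx L V) : Ctx L V

/-- `C.plug t` is `C[t]`, the result of filling the hole of `C` with `t`. -/
def Ctx.plug : Ctx L V → L.Term V → L.Term V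
  | .hole, t => t
  | .app f ts i C, t => FirstOrder.Language.Term.func f (Function.update ts i (C.plug t))

/-- `s` is a proper subterm of `t`. -/
def ProperSubterm (s t : L.Term V) : Prop :=
  ∃ C : Ctx L V, C ≠ Ctx.hole ∧ t = C.plug s

/-- The rewrite relation induced by a set of pairs of terms: its closure under contexts and
substitutions. -/
def Rew (A : Set (L.Term V × L.Term V)) (s t : L.Term V) : Prop :=
  ∃ l r : L.Term V, (l, r) ∈ A ∧ ∃ (C : Ctx L V) (σ : V → L.Term V),
    s = C.plug (l.subst σ) ∧ t = C.plug (r.subst σ)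

/-- Normal forms of a binary relation. -/
def NormalForm {α : Type*} (r : α → α → Prop) (a : α) : Prop := ∀ b, ¬ r a b

/-- Joinability `→* · *←` of the rewrite relation of `A`. -/
def Joinable (A : Set (L.Term V × L.Term V)) (s t : L.Term V) : Prop :=
  Relation.Join (Relation.ReflTransGen (Rew A)) s t

/-- Conversion of `A`: reflexive, symmetric and transitive closure of the rewrite relation. -/
def Conversion (A : Set (L.Term V × L.Term V)) (s t : L.Term V) : Prop :=
  Relation.EqvGen (Rew A) s t

/-- The symmetric closure of a set of pairs. -/
def symm (A : Set (L.Term V × L.Term V)) : Set (L.Term V × L.Term V) :=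
  {p | p ∈ A ∨ p.swap ∈ A}

/-- The set of pairs is terminating: there are no infinite rewrite sequences. -/
def Terminating (A : Set (L.Term V × L.Term V)) : Prop :=
  WellFounded fun t s : L.Term V => Rew A s t

/-- Ground confluence: ground terms `s`, `t` with `s *← · →* t` are joinable. -/
def GroundConfluent (A : Set (L.Term V × L.Term V)) : Prop :=
  ∀ s t : L.Term V, IsGround s → IsGround t →
    (∃ c, Relation.ReflTransGen (Rew A) c s ∧ Relation.ReflTransGen (Rew A) c t) →
      Joinable A s t

/-- Ground completeness: termination and ground confluence. -/
def GroundComplete (A : Set (L.Term V × L.Term V)) : Prop :=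
  Terminating A ∧ GroundConfluent A

/-- Reduction orders: well-founded (hence irreflexive) transitive relations on terms that are
closed under contexts and substitutions; `gt s t` means `s > t`. -/
structure IsReductionOrder (gt : L.Term V → L.Term V → Prop) : Prop where
  wf : WellFounded fun t s : L.Term V => gt s t
  trans : ∀ s t u : L.Term V, gt s t → gt t u → gt s u
  ctx : ∀ (C : Ctx L V) (s t : L.Term V), gt s t → gt (C.plug s) (C.plug t)
  subst : ∀ (σ : V → L.Term V) (s t : L.Term V), gt s t → gt (s.subst σ) (t.subst σ)

/-- Totality on ground terms. -/
def GroundTotal (gt : L.Term V → L.Term V → Prop) : Prop :=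
  ∀ s t : L.Term V, IsGround s → IsGround t → gt s t ∨ gt t s ∨ s = t

/-- `E^>`: all orientable instances `lσ → rσ`, `lσ > rσ`, of equations in `E` or their
reversals. -/
def ordInst (gt : L.Term V → L.Term V → Prop) (E : Set (L.Term V × L.Term V)) :
    Set (L.Term V × L.Term V) :=
  {p | ∃ l r : L.Term V, (l, r) ∈ symm E ∧ ∃ σ : V → L.Term V,
    gt (l.subst σ) (r.subst σ) ∧ p = (l.subst σ, r.subst σ)}

/-- The system `E^> ∪ R`. -/
def ordSystem (gt : L.Term V → L.Term V → Prop) (E R : Set (L.Term V × L.Term V)) :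
    Set (L.Term V × L.Term V) :=
  ordInst gt E ∪ R

/-- Encompassment: `s = C[tσ]` for some context `C` and substitution `σ`. -/
def Encompasses (s t : L.Term V) : Prop :=
  ∃ (C : Ctx L V) (σ : V → L.Term V), s = C.plug (t.subst σ)

/-- Proper encompassment. -/
def ProperEncompasses (s t : L.Term V) : Prop := Encompasses s t ∧ ¬ Encompasses t s

/-- A rewrite step from `t` to `u` with a rule of `R` whose left-hand side is properly encompassed
by `t`. -/
def RewEnc (R : Set (L.Term V × L.Term V)) (t u : L.Term V) : Prop :=
  ∃ l r : L.Term V, (l, r) ∈ R ∧ ∃ (C : Ctx L V) (σ : V → L.Term V),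
    t = C.plug (l.subst σ) ∧ u = C.plug (r.subst σ) ∧ ProperEncompasses t l

/-- An ordered rewrite step from `t` to `u` with an equation `l ≈ r` of `E` or its reversal such
that `l` (uninstantiated) is properly encompassed by `t`. -/
def OrdRewEnc (gt : L.Term V → L.Term V → Prop) (E : Set (L.Term V × L.Term V))
    (t u : L.Term V) : Prop :=
  ∃ l r : L.Term V, (l, r) ∈ symm E ∧ ∃ (C : Ctx L V) (σ : V → L.Term V),
    t = C.plug (l.subst σ) ∧ u = C.plug (r.subst σ) ∧ gt (l.subst σ) (r.subst σ) ∧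
      ProperEncompasses t l

/-- The steps used to simplify equations. -/
def SimplifyStep (gt : L.Term V → L.Term V → Prop) (E R : Set (L.Term V × L.Term V))
    (t u : L.Term V) : Prop :=
  Rew R t u ∨ OrdRewEnc gt E t u

/-- The steps used to collapse rules. -/
def CollapseStep (gt : L.Term V → L.Term V → Prop) (E R : Set (L.Term V × L.Term V))
    (t u : L.Term V) : Prop :=
  RewEnc R t u ∨ OrdRewEnc gt E t u

/-- The inference system of ordered completion: `Step gt E R E' R'` means that `(E', R')` is
obtained from `(E, R)` by one inference. The disjoint unions in the premises of the inference rules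
are expressed by `insert` together with a non-membership condition. -/
inductive Step (gt : L.Term V → L.Term V → Prop) :
    Set (L.Term V × L.Term V) → Set (L.Term V × L.Term V) →
    Set (L.Term V × L.Term V) → Set (L.Term V × L.Term V) → Prop
  | deduce (E R : Set (L.Term V × L.Term V)) (c s t : L.Term V)
      (hs : Rew (R ∪ symm E) c s) (ht : Rew (R ∪ symm E) c t) :
      Step gt E R (insert (s, t) E) R
  | orient_left (E R : Set (L.Term V × L.Term V)) (s t : L.Term V)
      (hn : (s, t) ∉ E) (h : gt s t) :
      Step gt (insert (s, t) E) R E (insert (s, t) R)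
  | orient_right (E R : Set (L.Term V × L.Term V)) (s t : L.Term V)
      (hn : (s, t) ∉ E) (h : gt t s) :
      Step gt (insert (s, t) E) R E (insert (t, s) R)
  | delete (E R : Set (L.Term V × L.Term V)) (s : L.Term V) (hn : (s, s) ∉ E) :
      Step gt (insert (s, s) E) R E R
  | compose (E R : Set (L.Term V × L.Term V)) (s t u : L.Term V)
      (hn : (s, t) ∉ R) (h : Rew (ordSystem gt E R) t u) :
      Step gt E (insert (s, t) R) E (insert (s, u) R)
  | simplify_left (E R : Set (L.Term V × L.Term V)) (s t u : L.Term V)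
      (hn : (s, t) ∉ E) (h : SimplifyStep gt E R s u) :
      Step gt (insert (s, t) E) R (insert (u, t) E) R
  | simplify_right (E R : Set (L.Term V × L.Term V)) (s t u : L.Term V)
      (hn : (s, t) ∉ E) (h : SimplifyStep gt E R t u) :
      Step gt (insert (s, t) E) R (insert (s, u) E) R
  | collapse (E R : Set (L.Term V × L.Term V)) (t s u : L.Term V)
      (hn : (t, s) ∉ R) (h : CollapseStep gt E R t u) :
      Step gt E (insert (t, s) R) (insert (u, s) E) R

/-- A run `(E 0, R 0) ⊢ (E 1, R 1) ⊢ ⋯` with `R 0 = ∅`, of length `N ≤ ∞`. Infinite runs have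
`N = ⊤`; a finite run is represented by repeating its last pair. -/
def IsRun (gt : L.Term V → L.Term V → Prop) (E R : ℕ → Set (L.Term V × L.Term V)) : Prop :=
  R 0 = ∅ ∧ ∃ N : ℕ∞, ∀ i : ℕ,
    ((i : ℕ∞) < N → Step gt (E i) (R i) (E (i + 1)) (R (i + 1))) ∧
    (N ≤ (i : ℕ∞) → E (i + 1) = E i ∧ R (i + 1) = R i)

/-- All elements ever occurring: `⋃ i, A i`. -/
def allOf (A : ℕ → Set (L.Term V × L.Term V)) : Set (L.Term V × L.Term V) :=
  ⋃ i, A i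

/-- The persistent elements: `⋃ i, ⋂ j ≥ i, A j`. -/
def persistent (A : ℕ → Set (L.Term V × L.Term V)) : Set (L.Term V × L.Term V) :=
  ⋃ i, ⋂ j ≥ i, A j

/-- `μ` is a most general unifier of `s` and `t`. -/
def IsMGU (μ : V → L.Term V) (s t : L.Term V) : Prop :=
  s.subst μ = t.subst μ ∧
    ∀ θ : V → L.Term V, s.subst θ = t.subst θ →
      ∃ ρ : V → L.Term V, ∀ x, θ x = (μ x).subst ρ

/-- `(l, r)` is a variant (renamed by a permutation of the variables) of an element of `A`. -/
def VariantIn (A : Set (L.Term V × L.Term V)) (l r : L.Term V) : Prop :=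
  ∃ π : Equiv.Perm V, (l.relabel π, r.relabel π) ∈ A

/-- Extended overlaps `⟨l₁ ≈ r₁, p, l₂ ≈ r₂⟩` of `E` with most general unifier `μ`. The position
`p` of `l₂` is given by the context `C` around it and the subterm `u` at it, so that `l₂ = C[u]`
and, for instance, `l₂[r₁]ₚ` is `C[r₁]`; it is a function symbol position iff `u` is not a
variable. -/
structure IsExtOverlap (gt : L.Term V → L.Term V → Prop) (E : Set (L.Term V × L.Term V))
    (l₁ r₁ : L.Term V) (C : Ctx L V) (u l₂ r₂ : L.Term V) (μ : V → L.Term V) : Prop where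
  variant₁ : VariantIn (symm E) l₁ r₁
  variant₂ : VariantIn (symm E) l₂ r₂
  disjoint : Disjoint (vars l₁ ∪ vars r₁) (vars l₂ ∪ vars r₂)
  position : l₂ = C.plug u
  nonvar : ¬ IsVar u
  mgu : IsMGU μ l₁ u
  not_gt₁ : ¬ gt (r₁.subst μ) (l₁.subst μ)
  not_gt₂ : ¬ gt (r₂.subst μ) (l₂.subst μ)

/-- `PCP_>(E)`: the pairs `l₂[r₁]ₚμ ≈ r₂μ` obtained from extended overlaps of `E` such that all
proper subterms of `l₁μ` are `E^>`-normal forms. -/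
def extPCP (gt : L.Term V → L.Term V → Prop) (E : Set (L.Term V × L.Term V)) :
    Set (L.Term V × L.Term V) :=
  {p | ∃ (l₁ r₁ : L.Term V) (C : Ctx L V) (u l₂ r₂ : L.Term V) (μ : V → L.Term V),
    IsExtOverlap gt E l₁ r₁ C u l₂ r₂ μ ∧
    (∀ s, ProperSubterm s (l₁.subst μ) → NormalForm (Rew (ordInst gt E)) s) ∧
    p = ((C.plug r₁).subst μ, r₂.subst μ)}

/-- Fairness of a run: each extended prime critical pair among persistent equations and rules is
joinable in `E_ω^> ∪ R_ω` or is a single step (in either direction) with an equation that occurs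
in the run. -/
def IsFair (gt : L.Term V → L.Term V → Prop) (E R : ℕ → Set (L.Term V × L.Term V)) : Prop :=
  ∀ s t : L.Term V, (s, t) ∈ extPCP gt (persistent E ∪ persistent R) →
    Joinable (ordSystem gt (persistent E) (persistent R)) s t ∨
      (Rew (allOf E) s t ∨ Rew (allOf E) t s)

end OrderedCompletion

/-!
Ordered completion is correct for three reasons.

* *Persistence.* An equation or rule that is removed during the run is replaced by a conversion of
  smaller steps (`IsRun.equation_cases`, `IsRun.rule_cases`). A decreasing step is measured by its
  starting term, then by the encompassment rank of its left-hand side (`encRank`; an equation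
  counting more than a rule of the same rank), then by its final term. An equation step that is
  not decreasing is measured by its two terms. By well-founded induction, every step with an
  equation that ever occurs has a conversion with persistent equations and rules, and since the
  replacing steps pass only through terms below the given ones, this conversion stays inside any
  given downward closed set containing the two ends (`IsRun.convIn_of_rew`). Taking the set of all
  terms, this gives one inclusion of conversions; the other is soundness of the inference rules
  (`IsRun.sound`).

* *Local peaks.* Let `S` be the system `E_ω^> ∪ R_ω`. Every ground peak of `S` is connected
  below its source `c`, i.e. by a conversion through terms smaller than `c`. To see this, choose a
  redex of `c` all of whose proper subterms are normal forms and reduce it to `e`; this splits the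
  peak into two (`IsRun.convIn_of_peak`), each with a step at a minimal redex. Peaks with such a
  step are either parallel, or overlap in a variable, in which case ground totality of the order
  closes the peak, or are instances of extended prime critical pairs (`exists_extPCP`, which rests
  on the existence of most general unifiers and on renaming equations apart). In the last case,
  fairness provides joinability or an equation that occurs in the run, to which persistence applies
  with the set of terms below `c` (`IsRun.convIn_of_root_peak`).

* *Confluence.* A terminating relation whose local peaks are connected below their sources is
  confluent (`join_of_connected_below`). Intermediate terms that are not ground are made ground by
  substituting a fixed ground term for all variables.
-/

namespace OrderedCompletion

open FirstOrder.Language Relation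

variable {L : FirstOrder.Language.{u, v}} {V : Type w}

/-! ### Terms, substitutions and contexts -/

@[simp]
theorem mem_vars_var {x y : V} : x ∈ vars (Term.var y : L.Term V) ↔ x = y := by
  simp [vars]

@[simp]
theorem mem_vars_func {n : ℕ} {f : L.Functions n} {ts : Fin n → L.Term V} {x : V} :
    x ∈ vars (Term.func f ts) ↔ ∃ i, x ∈ vars (ts i) := by
  simp [vars]

theorem finite_vars (t : L.Term V) : (vars t).Finite := by
  classical
  refine t.varFinset.finite_toSet.subset fun x hx => Finset.mem_coe.2 ?_
  simpa [vars] using hx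

theorem subst_subst (t : L.Term V) (σ τ : V → L.Term V) :
    (t.subst σ).subst τ = t.subst fun x => (σ x).subst τ := by
  induction t with
  | var => rfl
  | func f ts ih => simp only [Term.subst, ih]

theorem subst_var (t : L.Term V) : t.subst Term.var = t := by
  induction t with
  | var => rfl
  | func f ts ih => simp only [Term.subst, ih]

theorem subst_congr {t : L.Term V} {σ τ : V → L.Term V} (h : ∀ x ∈ vars t, σ x = τ x) :
    t.subst σ = t.subst τ := by
  induction t with
  | var x => exact h x (by simp)
  | func f ts ih =>
    simp only [Term.subst]
    congr 1
    funext i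
    exact ih i fun x hx => h x (mem_vars_func.2 ⟨i, hx⟩)

theorem subst_eq_self {t : L.Term V} {σ : V → L.Term V} (h : ∀ x ∈ vars t, σ x = Term.var x) :
    t.subst σ = t :=
  (subst_congr h).trans (subst_var t)

theorem mem_vars_subst {t : L.Term V} {σ : V → L.Term V} {x : V} :
    x ∈ vars (t.subst σ) ↔ ∃ y ∈ vars t, x ∈ vars (σ y) := by
  induction t with
  | var y => simp [Term.subst]
  | func f ts ih =>
    simp only [Term.subst, mem_vars_func, ih]
    grind

theorem relabel_eq_subst (t : L.Term V) (g : V → V) :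
    t.relabel g = t.subst fun x => Term.var (g x) := by
  induction t with
  | var => rfl
  | func f ts ih => simp only [Term.relabel, Term.subst, ih]

/-- Application of a substitution to a context. -/
def Ctx.subst (σ : V → L.Term V) : Ctx L V → Ctx L V
  | .hole => .hole
  | .app f ts i C => .app f (fun j => (ts j).subst σ) i (C.subst σ)

/-- The composition of contexts: `C.comp D` is `C[D]`. -/
def Ctx.comp : Ctx L V → Ctx L V → Ctx L V
  | .hole, D => D
  | .app f ts i C, D => .app f ts i (C.comp D)

theorem subst_plug (C : Ctx L V) (t : L.Term V) (σ : V → L.Term V) :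
    (C.plug t).subst σ = (C.subst σ).plug (t.subst σ) := by
  induction C with
  | hole => rfl
  | app f ts i C ih =>
    simp only [Ctx.plug, Ctx.subst, Term.subst]
    congr 1
    funext j
    by_cases h : j = i
    · subst h; simp [ih]
    · simp [h]

theorem plug_comp (C D : Ctx L V) (t : L.Term V) : (C.comp D).plug t = C.plug (D.plug t) := by
  induction C with
  | hole => rfl
  | app f ts i C ih => simp only [Ctx.plug, Ctx.comp, ih]

theorem Ctx.subst_ne_hole {C : Ctx L V} (h : C ≠ .hole) (σ : V → L.Term V) :
    C.subst σ ≠ .hole := by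
  cases C with
  | hole => exact absurd rfl h
  | app f ts i C => simp [Ctx.subst]

theorem ProperSubterm.subst {s t : L.Term V} (h : ProperSubterm s t) (σ : V → L.Term V) :
    ProperSubterm (s.subst σ) (t.subst σ) := by
  obtain ⟨C, hC, rfl⟩ := h
  exact ⟨C.subst σ, Ctx.subst_ne_hole hC σ, subst_plug ..⟩

/-- The size of a term. Function symbols have weight 2 and variables weight 1, so that replacing a
variable by a constant increases the size. -/
def tsize : L.Term V → ℕ
  | .var _ => 1
  | .func _ ts => 2 + ∑ i, tsize (ts i)

theorem tsize_pos (t : L.Term V) : 0 < tsize t := by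
  cases t <;> simp [tsize]

theorem tsize_arg_lt {n : ℕ} (f : L.Functions n) (ts : Fin n → L.Term V) (i : Fin n) :
    tsize (ts i) < tsize (Term.func f ts) := by
  have := Finset.single_le_sum (f := fun i => tsize (ts i)) (fun _ _ => Nat.zero_le _)
    (Finset.mem_univ i)
  simp only [tsize]
  omega

theorem tsize_le_plug (C : Ctx L V) (t : L.Term V) :
    tsize t ≤ tsize (C.plug t) ∧ (C ≠ .hole → tsize t < tsize (C.plug t)) := by
  induction C with
  | hole => simp [Ctx.plug]
  | app f ts i C ih =>
    have := tsize_arg_lt f (Function.update ts i (C.plug t)) i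
    simp only [Function.update_self] at this
    exact ⟨by simp only [Ctx.plug]; omega, fun _ => by simp only [Ctx.plug]; omega⟩

theorem ProperSubterm.tsize_lt {s t : L.Term V} (h : ProperSubterm s t) : tsize s < tsize t := by
  obtain ⟨C, hC, rfl⟩ := h
  exact (tsize_le_plug C s).2 hC

theorem tsize_le_subst (t : L.Term V) (σ : V → L.Term V) : tsize t ≤ tsize (t.subst σ) := by
  induction t with
  | var x => exact tsize_pos _
  | func f ts ih =>
    simp only [tsize, Term.subst]
    have := Finset.sum_le_sum fun i (_ : i ∈ Finset.univ) => ih i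
    omega

theorem exists_plug_of_mem_vars {t : L.Term V} {x : V} (h : x ∈ vars t) :
    ∃ C : Ctx L V, t = C.plug (Term.var x) := by
  induction t with
  | var y => exact ⟨.hole, by simp_all [Ctx.plug]⟩
  | func f ts ih =>
    obtain ⟨i, hi⟩ := mem_vars_func.1 h
    obtain ⟨C, hC⟩ := ih i hi
    exact ⟨.app f ts i C, by simp [Ctx.plug, ← hC]⟩

/-! ### Rewrite relations -/

theorem Rew.plug {A : Set (L.Term V × L.Term V)} {s t : L.Term V} (h : Rew A s t) (C : Ctx L V) :
    Rew A (C.plug s) (C.plug t) := by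
  obtain ⟨l, r, hA, D, σ, rfl, rfl⟩ := h
  exact ⟨l, r, hA, C.comp D, σ, by rw [plug_comp], by rw [plug_comp]⟩

theorem Rew.subst {A : Set (L.Term V × L.Term V)} {s t : L.Term V} (h : Rew A s t)
    (σ : V → L.Term V) : Rew A (s.subst σ) (t.subst σ) := by
  obtain ⟨l, r, hA, D, τ, rfl, rfl⟩ := h
  exact ⟨l, r, hA, D.subst σ, fun x => (τ x).subst σ, by rw [subst_plug, subst_subst],
    by rw [subst_plug, subst_subst]⟩

theorem Rew.mono {A B : Set (L.Term V × L.Term V)} (hAB : A ⊆ B) {s t : L.Term V}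
    (h : Rew A s t) : Rew B s t := by
  obtain ⟨l, r, hA, h⟩ := h
  exact ⟨l, r, hAB hA, h⟩

theorem Rew.of_mem {A : Set (L.Term V × L.Term V)} {s t : L.Term V} (h : (s, t) ∈ A) :
    Rew A s t :=
  ⟨s, t, h, .hole, Term.var, by simp [Ctx.plug, subst_var], by simp [Ctx.plug, subst_var]⟩

theorem rew_symm {A : Set (L.Term V × L.Term V)} {s t : L.Term V} (h : Rew (symm A) s t) :
    Rew A s t ∨ Rew A t s := by
  obtain ⟨l, r, hA | hA, C, σ, hs, ht⟩ := h
  · exact .inl ⟨l, r, hA, C, σ, hs, ht⟩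
  · exact .inr ⟨r, l, hA, C, σ, ht, hs⟩

theorem reflTransGen_plug {A : Set (L.Term V × L.Term V)} {s t : L.Term V}
    (h : ReflTransGen (Rew A) s t) (C : Ctx L V) :
    ReflTransGen (Rew A) (C.plug s) (C.plug t) :=
  h.lift C.plug fun _ _ h => h.plug C

theorem reflTransGen_subst {A : Set (L.Term V × L.Term V)} {s t : L.Term V}
    (h : ReflTransGen (Rew A) s t) (σ : V → L.Term V) :
    ReflTransGen (Rew A) (s.subst σ) (t.subst σ) :=
  h.lift (fun t => t.subst σ) fun _ _ h => h.subst σ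

theorem reflTransGen_func {A : Set (L.Term V × L.Term V)} {n : ℕ} (f : L.Functions n)
    {ts us : Fin n → L.Term V} (h : ∀ i, ReflTransGen (Rew A) (ts i) (us i)) :
    ReflTransGen (Rew A) (Term.func f ts) (Term.func f us) := by
  classical
  -- the arguments in `s` are rewritten one after the other
  suffices H : ∀ s : Finset (Fin n),
      ReflTransGen (Rew A) (Term.func f ts) (Term.func f (s.piecewise us ts)) by
    simpa using H Finset.univ
  intro s
  induction s using Finset.induction_on with
  | empty => simp [ReflTransGen.refl]
  | insert i s hi ih =>
    refine ih.trans ?_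
    have := reflTransGen_plug (h i) (.app f (s.piecewise us ts) i .hole)
    simp only [Ctx.plug] at this
    rw [Finset.piecewise_insert]
    convert this using 2
    rw [eq_comm, Function.update_eq_self_iff, Finset.piecewise_eq_of_notMem _ _ _ hi]

theorem reflTransGen_subst_pointwise {A : Set (L.Term V × L.Term V)} {σ τ : V → L.Term V}
    (h : ∀ x, ReflTransGen (Rew A) (σ x) (τ x)) (t : L.Term V) :
    ReflTransGen (Rew A) (t.subst σ) (t.subst τ) := by
  induction t with
  | var x => exact h x
  | func f ts ih => exact reflTransGen_func f ih

/-! ### Most general unifiers -/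

/-- Occurs check: a term properly containing `x` is not unifiable with `x`. -/
theorem notMem_vars_of_unifier {x : V} {n : ℕ} {f : L.Functions n} {ts : Fin n → L.Term V}
    {θ : V → L.Term V} (h : θ x = (Term.func f ts).subst θ) : x ∉ vars (Term.func f ts) := by
  intro hx
  obtain ⟨i, hi⟩ := mem_vars_func.1 hx
  obtain ⟨C, hC⟩ := exists_plug_of_mem_vars hi
  have h₁ := tsize_arg_lt f (fun i => (ts i).subst θ) i
  have h₂ : tsize (θ x) ≤ tsize ((ts i).subst θ) := by
    rw [hC, subst_plug]
    exact (tsize_le_plug _ _).1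
  rw [h] at h₂
  simp only [Term.subst] at h₂
  omega

/-- Two distinct unifiable terms have a disagreement pair `x`, `t'`: a variable and a term not
containing it that every unifier of the two terms identifies. -/
theorem exists_disagreement (s t : L.Term V) (hne : s ≠ t) (θ : V → L.Term V)
    (hθ : s.subst θ = t.subst θ) :
    ∃ (x : V) (t' : L.Term V), x ∉ vars t' ∧ x ∈ vars s ∪ vars t ∧ vars t' ⊆ vars s ∪ vars t ∧
      ∀ θ' : V → L.Term V, s.subst θ' = t.subst θ' → θ' x = t'.subst θ' := by
  induction s generalizing t with
  | var x =>
    cases t with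
    | var y =>
      exact ⟨x, Term.var y, by simpa using fun h => hne (by rw [h]), by simp, by
        intro z; simp; tauto, fun θ' h => h⟩
    | func f ts =>
      exact ⟨x, Term.func f ts, notMem_vars_of_unifier hθ, by simp, Set.subset_union_right,
        fun θ' h => h⟩
  | func f ts ih =>
    cases t with
    | var y =>
      exact ⟨y, Term.func f ts, notMem_vars_of_unifier hθ.symm, by simp, Set.subset_union_left,
        fun θ' h => h.symm⟩
    | func g us =>
      simp only [Term.subst, Term.func.injEq] at hθ
      obtain ⟨rfl, hfg, hθ⟩ := hθ
      obtain rfl := eq_of_heq hfg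
      rw [heq_eq_eq, funext_iff] at hθ
      obtain ⟨i, hi⟩ : ∃ i, ts i ≠ us i := by
        by_contra! h
        exact hne (by rw [funext h])
      obtain ⟨x, t', h₁, h₂, h₃, h₄⟩ := ih i (us i) hi (hθ i)
      have hsub : vars (ts i) ∪ vars (us i) ⊆ vars (Term.func f ts) ∪ vars (Term.func f us) :=
        Set.union_subset_union (fun z hz => mem_vars_func.2 ⟨i, hz⟩)
          (fun z hz => mem_vars_func.2 ⟨i, hz⟩)
      refine ⟨x, t', h₁, hsub h₂, h₃.trans hsub, fun θ' h => h₄ θ' ?_⟩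
      simp only [Term.subst, Term.func.injEq, heq_eq_eq, true_and] at h
      exact congrFun h i

/-- Unifiable terms have a most general unifier. The proof eliminates the variable of a
disagreement pair, by induction on the number of variables of the two terms. -/
theorem exists_isMGU (s t : L.Term V) (θ : V → L.Term V) (hθ : s.subst θ = t.subst θ) :
    ∃ μ, IsMGU μ s t := by
  classical
  induction hn : (vars s ∪ vars t).ncard using Nat.strong_induction_on generalizing s t with
  | _ n ih =>
  by_cases hne : s = t
  · subst hne
    exact ⟨Term.var, rfl, fun θ _ => ⟨θ, fun x => rfl⟩⟩
  obtain ⟨x, t', hx, hxs, ht', hdis⟩ := exists_disagreement s t hne θ hθ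
  set σ : V → L.Term V := Function.update Term.var x t' with hσ
  have hfac : ∀ θ' : V → L.Term V, s.subst θ' = t.subst θ' →
      ∀ y, θ' y = (σ y).subst θ' := by
    intro θ' h y
    by_cases hy : y = x
    · subst hy
      simpa [hσ] using hdis θ' h
    · simp [hσ, hy, Term.subst]
  have hvars : ∀ r : L.Term V, vars r ⊆ vars s ∪ vars t →
      vars (r.subst σ) ⊆ (vars s ∪ vars t) \ {x} := by
    intro r hr y hy
    obtain ⟨z, hz, hy⟩ := mem_vars_subst.1 hy
    by_cases hzx : z = x
    · subst hzx
      simp only [hσ, Function.update_self] at hy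
      exact ⟨ht' hy, fun h => hx (by rwa [Set.mem_singleton_iff.1 h] at hy)⟩
    · simp only [hσ, Function.update_of_ne hzx, mem_vars_var] at hy
      subst hy
      exact ⟨hr hz, hzx⟩
  have hσθ : ∀ θ' : V → L.Term V, s.subst θ' = t.subst θ' →
      (s.subst σ).subst θ' = (t.subst σ).subst θ' := by
    intro θ' h
    rw [subst_subst, subst_subst, ← funext (hfac θ' h), h]
  have hfin := (finite_vars s).union (finite_vars t)
  have hlt : (vars (s.subst σ) ∪ vars (t.subst σ)).ncard < n := by
    rw [← hn]
    refine Set.ncard_lt_ncard (Set.ssubset_of_subset_of_ssubset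
      (Set.union_subset (hvars s Set.subset_union_left) (hvars t Set.subset_union_right)) ?_) hfin
    exact Set.sdiff_singleton_ssubset.2 hxs
  obtain ⟨μ, hμ, hmgu⟩ := ih _ hlt (s.subst σ) (t.subst σ) (hσθ θ hθ) rfl
  refine ⟨fun y => (σ y).subst μ, by rw [← subst_subst, hμ, subst_subst], fun θ' h => ?_⟩
  obtain ⟨ρ, hρ⟩ := hmgu θ' (hσθ θ' h)
  refine ⟨ρ, fun y => ?_⟩
  rw [subst_subst, ← funext hρ]
  exact hfac θ' h y

/-! ### Renaming apart -/

/-- Finitely many variables can be renamed away from finitely many others: by induction, each new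
image that may be forbidden is swapped with a fresh variable. -/
theorem exists_perm_disjoint [Infinite V] {A B : Set V} (hA : A.Finite) (hB : B.Finite) :
    ∃ π : Equiv.Perm V, ∀ x ∈ A, π x ∉ B := by
  classical
  induction A, hA using Set.Finite.induction_on with
  | empty => exact ⟨1, by simp⟩
  | @insert a A ha hA ih =>
    obtain ⟨π, hπ⟩ := ih
    obtain ⟨z, hz⟩ := (hB.union (hA.image π)).exists_notMem
    refine ⟨π.trans (Equiv.swap (π a) z), ?_⟩
    rintro x (rfl | hx)
    · simpa using fun h => hz (.inl h)
    · have h₁ : π x ≠ π a := fun h => ha (π.injective h ▸ hx)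
      have h₂ : π x ≠ z := fun h => hz (.inr ⟨x, hx, h⟩)
      simpa [Equiv.swap_apply_of_ne_of_ne h₁ h₂] using hπ x hx

/-! ### Encompassment -/

/-- The size of a term, refined by its number of distinct variables (fewer variables count as
larger) so as to be strictly monotone for proper encompassment. The square makes the
size dominate. -/
noncomputable def encRank (t : L.Term V) : ℕ := (tsize t + 1) ^ 2 - (vars t).ncard

theorem ncard_vars_le (t : L.Term V) : (vars t).ncard ≤ tsize t := by
  induction t with
  | var x =>
    have : vars (Term.var x : L.Term V) = {x} := by ext; simp
    simp [this, tsize]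
  | func f ts ih =>
    have : vars (Term.func f ts) = ⋃ i ∈ (Finset.univ : Finset (Fin _)), vars (ts i) := by
      ext; simp
    rw [this]
    refine (Finset.set_ncard_biUnion_le _ _).trans ?_
    have := Finset.sum_le_sum fun i (_ : i ∈ Finset.univ) => ih i
    simp only [tsize]
    omega

/-- An instance of the same size is obtained by renaming variables. -/
theorem exists_var_of_tsize_subst {t : L.Term V} {σ : V → L.Term V}
    (h : tsize (t.subst σ) = tsize t) : ∀ x ∈ vars t, ∃ y, σ x = Term.var y := by
  induction t with
  | var x =>
    intro z hz
    rw [mem_vars_var] at hz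
    subst hz
    simp only [Term.subst, tsize] at h
    match hσ : σ z with
    | .var y => exact ⟨y, rfl⟩
    | .func f ts =>
      rw [hσ] at h
      simp only [tsize] at h
      omega
  | func f ts ih =>
    intro x hx
    obtain ⟨i, hi⟩ := mem_vars_func.1 hx
    refine ih i ?_ x hi
    simp only [tsize, Term.subst] at h
    have h' : ∑ i, tsize ((ts i).subst σ) = ∑ i, tsize (ts i) := by omega
    exact ((Finset.sum_eq_sum_iff_of_le fun i _ => tsize_le_subst (ts i) σ).1 h'.symm i
      (Finset.mem_univ i)).symm

/-- Encompassed terms have smaller or equal rank, and smaller rank if they are properly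
encompassed: between terms of equal size, encompassment is a renaming of variables that may identify
some of them, and if it does not, it can be inverted. -/
theorem Encompasses.encRank_le {s t : L.Term V} (h : Encompasses s t) :
    encRank t ≤ encRank s ∧ (¬ Encompasses t s → encRank t < encRank s) := by
  classical
  obtain ⟨C, σ, rfl⟩ := h
  have hle : tsize t ≤ tsize (C.plug (t.subst σ)) :=
    (tsize_le_subst t σ).trans (tsize_le_plug C _).1
  have hv := ncard_vars_le t
  have hv' := ncard_vars_le (C.plug (t.subst σ))
  rcases hle.lt_or_eq with hlt | heq
  · have : encRank t < encRank (C.plug (t.subst σ)) := by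
      have h₁ : encRank t ≤ (tsize t + 1) ^ 2 := Nat.sub_le _ _
      have h₂ : (tsize t + 1) ^ 2 + tsize (C.plug (t.subst σ)) <
          (tsize (C.plug (t.subst σ)) + 1) ^ 2 := by nlinarith
      have h₃ : encRank (C.plug (t.subst σ)) =
        (tsize (C.plug (t.subst σ)) + 1) ^ 2 - (vars (C.plug (t.subst σ))).ncard := rfl
      omega
    exact ⟨this.le, fun _ => this⟩
  · have hC : C = .hole := by
      by_contra hC
      have := (tsize_le_plug C (t.subst σ)).2 hC
      have := tsize_le_subst t σ
      omega
    subst hC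
    simp only [Ctx.plug] at *
    have hσ := exists_var_of_tsize_subst heq.symm
    choose! g hg using hσ
    have himg : vars (t.subst σ) = g '' vars t := by
      ext y
      rw [mem_vars_subst]
      constructor
      · rintro ⟨x, hx, hy⟩
        rw [hg x hx, mem_vars_var] at hy
        exact ⟨x, hx, hy.symm⟩
      · rintro ⟨x, hx, rfl⟩
        exact ⟨x, hx, by rw [hg x hx]; simp⟩
    have hcard : (vars (t.subst σ)).ncard ≤ (vars t).ncard := by
      rw [himg]
      exact Set.ncard_image_le (finite_vars t)
    have hsq : tsize t ≤ (tsize t + 1) ^ 2 := by nlinarith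
    refine ⟨by simp only [encRank, ← heq]; omega, fun hnot => ?_⟩
    have hlt : (vars (t.subst σ)).ncard < (vars t).ncard := by
      refine hcard.lt_of_ne fun hcard => hnot ?_
      rw [himg, Set.ncard_image_iff (finite_vars t)] at hcard
      -- the renaming is injective on the variables of `t`, hence invertible
      rcases isEmpty_or_nonempty V with hV | hV
      · refine ⟨.hole, σ, ?_⟩
        simp only [Ctx.plug, subst_subst]
        exact (subst_eq_self fun x _ => hV.elim x).symm
      · refine ⟨.hole, fun y => Term.var (Function.invFunOn g (vars t) y), ?_⟩
        simp only [Ctx.plug, subst_subst]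
        refine (subst_eq_self fun x hx => ?_).symm
        rw [hg x hx]
        simp only [Term.subst]
        rw [hcard.leftInvOn_invFunOn hx]
    simp only [encRank, ← heq]
    omega

section

/-! ### Ordered rewriting -/

variable {gt : L.Term V → L.Term V → Prop}

theorem IsReductionOrder.irrefl (hgt : IsReductionOrder gt) (s : L.Term V) : ¬ gt s s :=
  fun h => hgt.wf.irrefl.irrefl s h

theorem IsReductionOrder.asymm (hgt : IsReductionOrder gt) {s t : L.Term V} (h : gt s t) :
    ¬ gt t s :=
  fun h' => hgt.irrefl s (hgt.trans _ _ _ h h')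

/-- A set of pairs is decreasing if left-hand sides are greater than right-hand sides. -/
def Decreasing (gt : L.Term V → L.Term V → Prop) (A : Set (L.Term V × L.Term V)) : Prop :=
  ∀ s t, (s, t) ∈ A → gt s t

theorem Decreasing.gt_of_rew (hgt : IsReductionOrder gt) {A : Set (L.Term V × L.Term V)}
    (hA : Decreasing gt A) {s t : L.Term V} (h : Rew A s t) : gt s t := by
  obtain ⟨l, r, hlr, C, σ, rfl, rfl⟩ := h
  exact hgt.ctx _ _ _ (hgt.subst _ _ _ (hA _ _ hlr))

theorem Decreasing.ordSystem {E R : Set (L.Term V × L.Term V)} (hR : Decreasing gt R) :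
    Decreasing gt (ordSystem gt E R) := by
  rintro s t (⟨l, r, -, σ, h, heq⟩ | h)
  · obtain ⟨rfl, rfl⟩ := Prod.mk.inj heq
    exact h
  · exact hR _ _ h

theorem symm_mono {A B : Set (L.Term V × L.Term V)} (h : A ⊆ B) : symm A ⊆ symm B :=
  fun _ hp => hp.imp (fun hp => h hp) (fun hp => h hp)

theorem mem_symm_swap {A : Set (L.Term V × L.Term V)} {s t : L.Term V} (h : (s, t) ∈ symm A) :
    (t, s) ∈ symm A :=
  h.symm

theorem ordInst_mono {A B : Set (L.Term V × L.Term V)} (h : A ⊆ B) :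
    ordInst gt A ⊆ ordInst gt B := by
  rintro p ⟨l, r, hlr, hp⟩
  exact ⟨l, r, symm_mono h hlr, hp⟩

/-- Rewriting with `E^> ∪ R`, for `R` contained in `>`, is rewriting with the decreasing instances
of `E ∪ R`. -/
theorem rew_ordSystem_iff (hgt : IsReductionOrder gt) {E R : Set (L.Term V × L.Term V)}
    (hR : Decreasing gt R) {s t : L.Term V} :
    Rew (ordSystem gt E R) s t ↔ ∃ l r : L.Term V, (l, r) ∈ symm (E ∪ R) ∧
      ∃ (C : Ctx L V) (σ : V → L.Term V),
        s = C.plug (l.subst σ) ∧ t = C.plug (r.subst σ) ∧ gt (l.subst σ) (r.subst σ) := by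
  constructor
  · rintro ⟨l, r, ⟨l, r, hlr, τ, h, heq⟩ | hlr, C, σ, rfl, rfl⟩
    · obtain ⟨rfl, rfl⟩ := Prod.mk.inj heq
      refine ⟨l, r, symm_mono Set.subset_union_left hlr, C, fun x => (τ x).subst σ, ?_⟩
      rw [← subst_subst, ← subst_subst]
      exact ⟨rfl, rfl, hgt.subst _ _ _ h⟩
    · exact ⟨l, r, .inl (.inr hlr), C, σ, rfl, rfl, hgt.subst _ _ _ (hR _ _ hlr)⟩
  · rintro ⟨l, r, hlr, C, σ, rfl, rfl, h⟩
    by_cases hE : (l, r) ∈ symm E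
    · exact ⟨_, _, .inl ⟨l, r, hE, σ, h, rfl⟩, C, Term.var, by rw [subst_var], by rw [subst_var]⟩
    · rcases hlr with (hlr | hlr) | (hlr | hlr)
      · exact absurd (.inl hlr) hE
      · exact ⟨l, r, .inr hlr, C, σ, rfl, rfl⟩
      · exact absurd (.inr hlr) hE
      · exact absurd (hgt.subst σ _ _ (hR _ _ hlr)) (hgt.asymm h)

theorem rew_ordSystem_of_rew_ordInst (hgt : IsReductionOrder gt)
    {E R : Set (L.Term V × L.Term V)} (hR : Decreasing gt R) {s t : L.Term V}
    (h : Rew (ordInst gt (E ∪ R)) s t) : Rew (ordSystem gt E R) s t := by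
  obtain ⟨l, r, ⟨l, r, hlr, τ, h, heq⟩, C, σ, rfl, rfl⟩ := h
  obtain ⟨rfl, rfl⟩ := Prod.mk.inj heq
  rw [rew_ordSystem_iff hgt hR]
  refine ⟨l, r, hlr, C, fun x => (τ x).subst σ, ?_⟩
  rw [← subst_subst, ← subst_subst]
  exact ⟨rfl, rfl, hgt.subst _ _ _ h⟩

/-! ### Runs -/

theorem persistent_subset_allOf (A : ℕ → Set (L.Term V × L.Term V)) :
    persistent A ⊆ allOf A := by
  intro p hp
  obtain ⟨i, hi⟩ := Set.mem_iUnion.1 hp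
  exact Set.mem_iUnion.2 ⟨i, Set.mem_iInter₂.1 hi i le_rfl⟩

theorem subset_allOf (A : ℕ → Set (L.Term V × L.Term V)) (i : ℕ) : A i ⊆ allOf A :=
  Set.subset_iUnion A i

/-- An element that occurs but does not persist is removed at some point. -/
theorem exists_removed {A : ℕ → Set (L.Term V × L.Term V)} {p : L.Term V × L.Term V}
    (h : p ∈ allOf A) (hp : p ∉ persistent A) : ∃ i, p ∈ A i ∧ p ∉ A (i + 1) := by
  obtain ⟨i, hi⟩ := Set.mem_iUnion.1 h
  by_contra! hcon
  refine hp (Set.mem_iUnion.2 ⟨i, Set.mem_iInter₂.2 fun j hj => ?_⟩)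
  induction j, hj using Nat.le_induction with
  | base => exact hi
  | succ j _ ih => exact hcon j ih

variable {E R : ℕ → Set (L.Term V × L.Term V)}

theorem IsRun.step (hrun : IsRun gt E R) (i : ℕ) :
    Step gt (E i) (R i) (E (i + 1)) (R (i + 1)) ∨ E (i + 1) = E i ∧ R (i + 1) = R i := by
  obtain ⟨-, N, hN⟩ := hrun
  rcases lt_or_ge (i : ℕ∞) N with h | h
  · exact .inl ((hN i).1 h)
  · exact .inr ((hN i).2 h)

theorem Decreasing.step (hgt : IsReductionOrder gt) {E R E' R' : Set (L.Term V × L.Term V)}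
    (h : Step gt E R E' R') (hR : Decreasing gt R) : Decreasing gt R' := by
  have insert_iff : ∀ (s t : L.Term V) (A : Set (L.Term V × L.Term V)),
      Decreasing gt (insert (s, t) A) ↔ gt s t ∧ Decreasing gt A := fun s t A => by
    constructor
    · exact fun h => ⟨h _ _ (.inl rfl), fun a b hab => h _ _ (.inr hab)⟩
    · rintro ⟨h₁, h₂⟩ a b (hab | hab)
      · obtain ⟨rfl, rfl⟩ := Prod.mk.inj hab
        exact h₁
      · exact h₂ _ _ hab
  cases h with
  | deduce _ _ c s t hs ht => exact hR
  | orient_left _ _ s t hn h => exact (insert_iff ..).2 ⟨h, hR⟩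
  | orient_right _ _ s t hn h => exact (insert_iff ..).2 ⟨h, hR⟩
  | delete _ _ s hn => exact hR
  | compose _ _ s t u hn h =>
    rw [insert_iff] at hR ⊢
    exact ⟨hgt.trans _ _ _ hR.1 (hR.2.ordSystem.gt_of_rew hgt h), hR.2⟩
  | simplify_left _ _ s t u hn h => exact hR
  | simplify_right _ _ s t u hn h => exact hR
  | collapse _ _ t s u hn h => exact ((insert_iff ..).1 hR).2

theorem IsRun.decreasing (hgt : IsReductionOrder gt) (hrun : IsRun gt E R) :
    Decreasing gt (allOf R) := by
  suffices H : ∀ i, Decreasing gt (R i) by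
    intro s t h
    obtain ⟨i, hi⟩ := Set.mem_iUnion.1 h
    exact H i s t hi
  intro i
  induction i with
  | zero =>
    rw [hrun.1]
    exact fun _ _ h => absurd h (Set.notMem_empty _)
  | succ i ih =>
    rcases hrun.step i with h | ⟨-, h⟩
    · exact ih.step hgt h
    · rw [h]; exact ih

theorem IsRun.decreasing_persistent (hgt : IsReductionOrder gt) (hrun : IsRun gt E R) :
    Decreasing gt (persistent R) :=
  fun s t h => hrun.decreasing hgt s t (persistent_subset_allOf R h)

theorem SimplifyStep.mono {E R E' R' : Set (L.Term V × L.Term V)} (hE : E ⊆ E') (hR : R ⊆ R')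
    {s t : L.Term V} (h : SimplifyStep gt E R s t) : SimplifyStep gt E' R' s t := by
  rcases h with h | ⟨l, r, hlr, h⟩
  · exact .inl (h.mono hR)
  · exact .inr ⟨l, r, symm_mono hE hlr, h⟩

theorem CollapseStep.mono {E R E' R' : Set (L.Term V × L.Term V)} (hE : E ⊆ E') (hR : R ⊆ R')
    {s t : L.Term V} (h : CollapseStep gt E R s t) : CollapseStep gt E' R' s t := by
  rcases h with ⟨l, r, hlr, h⟩ | ⟨l, r, hlr, h⟩
  · exact .inl ⟨l, r, hR hlr, h⟩
  · exact .inr ⟨l, r, symm_mono hE hlr, h⟩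

/-- What becomes of an equation that occurs in a run: it persists, or it is oriented, deleted or
simplified. -/
theorem IsRun.equation_cases (hrun : IsRun gt E R) {s t : L.Term V} (h : (s, t) ∈ allOf E) :
    (s, t) ∈ persistent E ∨ (gt s t ∧ (s, t) ∈ allOf R) ∨ (gt t s ∧ (t, s) ∈ allOf R) ∨ s = t ∨
      (∃ u, SimplifyStep gt (allOf E) (allOf R) s u ∧ (u, t) ∈ allOf E) ∨
      (∃ u, SimplifyStep gt (allOf E) (allOf R) t u ∧ (s, u) ∈ allOf E) := by
  by_cases hp : (s, t) ∈ persistent E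
  · exact .inl hp
  right
  obtain ⟨i, hi, hi'⟩ := exists_removed h hp
  have hE := subset_allOf E i
  have hR := subset_allOf R i
  have hE' := subset_allOf E (i + 1)
  have hR' := subset_allOf R (i + 1)
  rcases hrun.step i with hstep | ⟨heq, -⟩
  swap
  · exact absurd hi (heq ▸ hi')
  generalize E i = A at *
  generalize E (i + 1) = A' at *
  generalize R i = B at *
  generalize R (i + 1) = B' at *
  have hsub : ∀ {p : L.Term V × L.Term V} {A : Set (L.Term V × L.Term V)},
      insert p A ⊆ allOf E → A ⊆ allOf E := fun h => (Set.subset_insert _ _).trans h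
  cases hstep with
  | deduce _ _ c s t hs ht => exact absurd (.inr hi) hi'
  | orient_left _ _ a b hn h =>
    rcases hi with hi | hi
    · obtain ⟨rfl, rfl⟩ := Prod.mk.inj hi
      exact .inl ⟨h, hR' (.inl rfl)⟩
    · exact absurd hi hi'
  | orient_right _ _ a b hn h =>
    rcases hi with hi | hi
    · obtain ⟨rfl, rfl⟩ := Prod.mk.inj hi
      exact .inr (.inl ⟨h, hR' (.inl rfl)⟩)
    · exact absurd hi hi'
  | delete _ _ a hn =>
    rcases hi with hi | hi
    · obtain ⟨rfl, rfl⟩ := Prod.mk.inj hi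
      exact .inr (.inr (.inl rfl))
    · exact absurd hi hi'
  | compose _ _ s t u hn h => exact absurd hi hi'
  | simplify_left _ _ a b c hn h =>
    rcases hi with hi | hi
    · obtain ⟨rfl, rfl⟩ := Prod.mk.inj hi
      exact .inr (.inr (.inr (.inl ⟨c, h.mono (hsub hE) hR, hE' (.inl rfl)⟩)))
    · exact absurd (.inr hi) hi'
  | simplify_right _ _ a b c hn h =>
    rcases hi with hi | hi
    · obtain ⟨rfl, rfl⟩ := Prod.mk.inj hi
      exact .inr (.inr (.inr (.inr ⟨c, h.mono (hsub hE) hR, hE' (.inl rfl)⟩)))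
    · exact absurd (.inr hi) hi'
  | collapse _ _ t s u hn h => exact absurd (.inr hi) hi'

/-- `IsRun.equation_cases` for equations used in either direction. -/
theorem IsRun.equation_cases_symm (hrun : IsRun gt E R) {s t : L.Term V}
    (h : (s, t) ∈ symm (allOf E)) :
    (s, t) ∈ symm (persistent E) ∨ (gt s t ∧ (s, t) ∈ allOf R) ∨ (gt t s ∧ (t, s) ∈ allOf R) ∨
      s = t ∨
      (∃ u, SimplifyStep gt (allOf E) (allOf R) s u ∧ (u, t) ∈ symm (allOf E)) ∨
      (∃ u, SimplifyStep gt (allOf E) (allOf R) t u ∧ (s, u) ∈ symm (allOf E)) := by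
  rcases h with h | h
  · rcases hrun.equation_cases h with h | h | h | h | ⟨u, h, h'⟩ | ⟨u, h, h'⟩
    · exact .inl (.inl h)
    · exact .inr (.inl h)
    · exact .inr (.inr (.inl h))
    · exact .inr (.inr (.inr (.inl h)))
    · exact .inr (.inr (.inr (.inr (.inl ⟨u, h, .inl h'⟩))))
    · exact .inr (.inr (.inr (.inr (.inr ⟨u, h, .inl h'⟩))))
  · rcases hrun.equation_cases h with h | h | h | h | ⟨u, h, h'⟩ | ⟨u, h, h'⟩
    · exact .inl (.inr h)
    · exact .inr (.inr (.inl h))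
    · exact .inr (.inl h)
    · exact .inr (.inr (.inr (.inl h.symm)))
    · exact .inr (.inr (.inr (.inr (.inr ⟨u, h, .inr h'⟩))))
    · exact .inr (.inr (.inr (.inr (.inl ⟨u, h, .inr h'⟩))))

/-- What becomes of a rule that occurs in a run: it persists, or it is composed or collapsed. -/
theorem IsRun.rule_cases (hrun : IsRun gt E R) {s t : L.Term V} (h : (s, t) ∈ allOf R) :
    (s, t) ∈ persistent R ∨
      (∃ u, Rew (ordSystem gt (allOf E) (allOf R)) t u ∧ (s, u) ∈ allOf R) ∨
      (∃ u, CollapseStep gt (allOf E) (allOf R) s u ∧ (u, t) ∈ allOf E) := by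
  by_cases hp : (s, t) ∈ persistent R
  · exact .inl hp
  right
  obtain ⟨i, hi, hi'⟩ := exists_removed h hp
  have hE := subset_allOf E i
  have hR := subset_allOf R i
  have hE' := subset_allOf E (i + 1)
  have hR' := subset_allOf R (i + 1)
  rcases hrun.step i with hstep | ⟨-, heq⟩
  swap
  · exact absurd hi (heq ▸ hi')
  generalize E i = A at *
  generalize E (i + 1) = A' at *
  generalize R i = B at *
  generalize R (i + 1) = B' at *
  have hsub : ∀ {p : L.Term V × L.Term V} {A : Set (L.Term V × L.Term V)},
      insert p A ⊆ allOf R → A ⊆ allOf R := fun h => (Set.subset_insert _ _).trans h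
  cases hstep with
  | deduce _ _ c s t hs ht => exact absurd hi hi'
  | orient_left _ _ a b hn h => exact absurd (.inr hi) hi'
  | orient_right _ _ a b hn h => exact absurd (.inr hi) hi'
  | delete _ _ a hn => exact absurd hi hi'
  | compose _ _ a b c hn h =>
    rcases hi with hi | hi
    · obtain ⟨rfl, rfl⟩ := Prod.mk.inj hi
      exact .inl ⟨c, h.mono (Set.union_subset_union (ordInst_mono hE) (hsub hR)), hR' (.inl rfl)⟩
    · exact absurd (.inr hi) hi'
  | simplify_left _ _ a b c hn h => exact absurd hi hi'
  | simplify_right _ _ a b c hn h => exact absurd hi hi'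
  | collapse _ _ a b c hn h =>
    rcases hi with hi | hi
    · obtain ⟨rfl, rfl⟩ := Prod.mk.inj hi
      exact .inr ⟨c, h.mono hE (hsub hR), hE' (.inl rfl)⟩
    · exact absurd hi hi'

/-! ### Soundness -/

theorem eqvGen_lift {α β : Type*} {r : α → α → Prop} {q : β → β → Prop} (f : α → β)
    (h : ∀ a b, r a b → EqvGen q (f a) (f b)) {a b : α} (hab : EqvGen r a b) :
    EqvGen q (f a) (f b) := by
  induction hab with
  | rel a b hab => exact h a b hab
  | refl a => exact .refl _
  | symm a b _ ih => exact .symm _ _ ih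
  | trans a b c _ _ ih₁ ih₂ => exact .trans _ _ _ ih₁ ih₂

theorem Conversion.of_rew {A B : Set (L.Term V × L.Term V)}
    (h : ∀ s t, (s, t) ∈ B → Conversion A s t) {s t : L.Term V} (hst : Rew B s t) :
    Conversion A s t := by
  obtain ⟨l, r, hlr, C, σ, rfl, rfl⟩ := hst
  exact eqvGen_lift (fun t => C.plug (t.subst σ))
    (fun s t h => .rel _ _ ((h.subst σ).plug C)) (h l r hlr)

theorem Conversion.of_conversion {A B : Set (L.Term V × L.Term V)}
    (h : ∀ s t, (s, t) ∈ B → Conversion A s t) {s t : L.Term V} (hst : Conversion B s t) :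
    Conversion A s t := by
  exact eqvGen_lift id (fun s t hst => Conversion.of_rew h hst) hst

/-- Every inference preserves inclusion of the equations and rules in a given conversion. -/
theorem Step.sound {E R E' R' : Set (L.Term V × L.Term V)} (h : Step gt E R E' R')
    {A : Set (L.Term V × L.Term V)} (hA : ∀ s t, (s, t) ∈ E ∪ R → Conversion A s t) :
    ∀ s t, (s, t) ∈ E' ∪ R' → Conversion A s t := by
  have ord : ∀ {E' R' : Set (L.Term V × L.Term V)}, E' ⊆ E → R' ⊆ R → ∀ {s t : L.Term V},
      Rew (R' ∪ symm E') s t → Conversion A s t := by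
    intro E' R' hE hR s t hst
    refine .of_rew (fun a b hab => ?_) hst
    rcases hab with hab | hab | hab
    · exact hA _ _ (.inr (hR hab))
    · exact hA _ _ (.inl (hE hab))
    · exact .symm _ _ (hA _ _ (.inl (hE hab)))
  have enc : ∀ {E' : Set (L.Term V × L.Term V)}, E' ⊆ E → ∀ {s t : L.Term V},
      OrdRewEnc gt E' s t → Conversion A s t := by
    rintro E' hE s t ⟨l, r, hlr, C, σ, hs, ht, -⟩
    exact ord hE (Set.empty_subset R) ⟨l, r, .inr hlr, C, σ, hs, ht⟩
  have simplify : ∀ {E' R' : Set (L.Term V × L.Term V)}, E' ⊆ E → R' ⊆ R → ∀ {s t : L.Term V},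
      SimplifyStep gt E' R' s t → Conversion A s t := by
    rintro E' R' hE hR s t (h | h)
    · exact ord hE hR (h.mono Set.subset_union_left)
    · exact enc hE h
  have collapse : ∀ {E' R' : Set (L.Term V × L.Term V)}, E' ⊆ E → R' ⊆ R → ∀ {s t : L.Term V},
      CollapseStep gt E' R' s t → Conversion A s t := by
    rintro E' R' hE hR s t (⟨l, r, hlr, C, σ, hs, ht, -⟩ | h)
    · exact ord hE hR ⟨l, r, .inl hlr, C, σ, hs, ht⟩
    · exact enc hE h
  intro a b hab
  cases h with
  | deduce _ _ c s t hs ht =>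
    rcases hab with (hab | hab) | hab
    · obtain ⟨rfl, rfl⟩ := Prod.mk.inj hab
      exact .trans _ _ _ (.symm _ _ (ord subset_rfl subset_rfl hs)) (ord subset_rfl subset_rfl ht)
    · exact hA _ _ (.inl hab)
    · exact hA _ _ (.inr hab)
  | orient_left _ _ s t hn h =>
    rcases hab with hab | hab | hab
    · exact hA _ _ (.inl (.inr hab))
    · exact hA _ _ (.inl (.inl hab))
    · exact hA _ _ (.inr hab)
  | orient_right _ _ s t hn h =>
    rcases hab with hab | hab | hab
    · exact hA _ _ (.inl (.inr hab))
    · obtain ⟨rfl, rfl⟩ := Prod.mk.inj hab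
      exact .symm _ _ (hA _ _ (.inl (.inl rfl)))
    · exact hA _ _ (.inr hab)
  | delete _ _ s hn =>
    rcases hab with hab | hab
    · exact hA _ _ (.inl (.inr hab))
    · exact hA _ _ (.inr hab)
  | compose _ R s t u hn h =>
    rcases hab with hab | hab | hab
    · exact hA _ _ (.inl hab)
    · obtain ⟨rfl, rfl⟩ := Prod.mk.inj hab
      refine .trans _ _ _ (hA _ _ (.inr (.inl rfl))) ?_
      obtain ⟨l, r, ⟨l, r, hlr, τ, -, heq⟩ | hlr, C, σ, rfl, rfl⟩ := h
      · obtain ⟨rfl, rfl⟩ := Prod.mk.inj heq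
        refine ord subset_rfl (Set.empty_subset _)
          ⟨l, r, .inr hlr, C, fun x => (τ x).subst σ, ?_, ?_⟩ <;> rw [subst_subst]
      · exact ord subset_rfl (Set.subset_insert _ _) ⟨l, r, .inl hlr, C, σ, rfl, rfl⟩
    · exact hA _ _ (.inr (.inr hab))
  | simplify_left _ _ s t u hn h =>
    rcases hab with (hab | hab) | hab
    · obtain ⟨rfl, rfl⟩ := Prod.mk.inj hab
      exact .trans _ _ _ (.symm _ _ (simplify (Set.subset_insert _ _) subset_rfl h))
        (hA _ _ (.inl (.inl rfl)))
    · exact hA _ _ (.inl (.inr hab))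
    · exact hA _ _ (.inr hab)
  | simplify_right _ _ s t u hn h =>
    rcases hab with (hab | hab) | hab
    · obtain ⟨rfl, rfl⟩ := Prod.mk.inj hab
      exact .trans _ _ _ (hA _ _ (.inl (.inl rfl))) (simplify (Set.subset_insert _ _) subset_rfl h)
    · exact hA _ _ (.inl (.inr hab))
    · exact hA _ _ (.inr hab)
  | collapse _ R t s u hn h =>
    rcases hab with (hab | hab) | hab
    · obtain ⟨rfl, rfl⟩ := Prod.mk.inj hab
      exact .trans _ _ _ (.symm _ _ (collapse subset_rfl (Set.subset_insert _ _) h))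
        (hA _ _ (.inr (.inl rfl)))
    · exact hA _ _ (.inl hab)
    · exact hA _ _ (.inr (.inr hab))

theorem IsRun.sound (hrun : IsRun gt E R) (i : ℕ) :
    ∀ s t, (s, t) ∈ E i ∪ R i → Conversion (E 0) s t := by
  induction i with
  | zero =>
    rw [hrun.1, Set.union_empty]
    exact fun s t h => .rel _ _ (.of_mem h)
  | succ i ih =>
    rcases hrun.step i with h | ⟨h₁, h₂⟩
    · exact h.sound ih
    · rw [h₁, h₂]; exact ih

end

section

/-! ### Persistence -/

/-- `ConvIn W A s t`: there is a conversion of `A` from `s` to `t` all of whose steps are between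
terms of `W`. -/
def ConvIn (W : Set (L.Term V)) (A : Set (L.Term V × L.Term V)) (s t : L.Term V) : Prop :=
  EqvGen (fun x y => x ∈ W ∧ y ∈ W ∧ Rew A x y) s t

variable {gt : L.Term V → L.Term V → Prop} {E R : ℕ → Set (L.Term V × L.Term V)}

/-- `WeightedStep E R k s t`: a step from `s` to `t` by an equation of `E` or its reversal,
or by a rule of `R`. The weight `k` grows with the encompassment rank of the left-hand side and,
for equal ranks, is larger for equations than for rules. -/
inductive WeightedStep (E R : Set (L.Term V × L.Term V)) : ℕ → L.Term V → L.Term V → Prop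
  | rule {l r : L.Term V} (h : (l, r) ∈ R) (C : Ctx L V) (σ : V → L.Term V) :
      WeightedStep E R (2 * encRank l) (C.plug (l.subst σ)) (C.plug (r.subst σ))
  | equation {l r : L.Term V} (h : (l, r) ∈ symm E) (C : Ctx L V) (σ : V → L.Term V) :
      WeightedStep E R (2 * encRank l + 1) (C.plug (l.subst σ)) (C.plug (r.subst σ))

theorem WeightedStep.plug_subst {E R : Set (L.Term V × L.Term V)} {k : ℕ} {s t : L.Term V}
    (h : WeightedStep E R k s t) (C : Ctx L V) (σ : V → L.Term V) :
    WeightedStep E R k (C.plug (s.subst σ)) (C.plug (t.subst σ)) := by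
  cases h with
  | rule h D τ =>
    simpa only [plug_comp, subst_plug, subst_subst] using
      WeightedStep.rule (E := E) h (C.comp (D.subst σ)) fun x => (τ x).subst σ
  | equation h D τ =>
    simpa only [plug_comp, subst_plug, subst_subst] using
      WeightedStep.equation (R := R) h (C.comp (D.subst σ)) fun x => (τ x).subst σ

/-- The steps that simplify an equation weigh less than steps with that equation at the simplified
side. -/
theorem SimplifyStep.weightedStep (hgt : IsReductionOrder gt) {E R : Set (L.Term V × L.Term V)}
    (hR : Decreasing gt R) {s t : L.Term V} (h : SimplifyStep gt E R s t) :
    gt s t ∧ ∃ k < 2 * encRank s + 1, WeightedStep E R k s t := by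
  rcases h with h | ⟨l, r, hlr, C, σ, rfl, rfl, h, henc, hnot⟩
  · refine ⟨hR.gt_of_rew hgt h, ?_⟩
    obtain ⟨l, r, hlr, C, σ, rfl, rfl⟩ := h
    have := (Encompasses.encRank_le (t := l) ⟨C, σ, rfl⟩).1
    exact ⟨_, by omega, .rule hlr C σ⟩
  · have := henc.encRank_le.2 hnot
    exact ⟨hgt.ctx _ _ _ h, _, by omega, .equation hlr C σ⟩

/-- The steps that collapse a rule weigh less than steps with that rule. -/
theorem CollapseStep.weightedStep (hgt : IsReductionOrder gt) {E R : Set (L.Term V × L.Term V)}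
    (hR : Decreasing gt R) {s t : L.Term V} (h : CollapseStep gt E R s t) :
    gt s t ∧ ∃ k < 2 * encRank s, WeightedStep E R k s t := by
  rcases h with ⟨l, r, hlr, C, σ, rfl, rfl, henc, hnot⟩ | ⟨l, r, hlr, C, σ, rfl, rfl, h, henc, hnot⟩
  · have := henc.encRank_le.2 hnot
    exact ⟨hgt.ctx _ _ _ (hgt.subst _ _ _ (hR _ _ hlr)), _, by omega, .rule hlr C σ⟩
  · have := henc.encRank_le.2 hnot
    exact ⟨hgt.ctx _ _ _ h, _, by omega, .equation hlr C σ⟩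

theorem exists_weightedStep {E R : Set (L.Term V × L.Term V)} {s t : L.Term V}
    (h : Rew (ordSystem gt E R) s t) : ∃ k, WeightedStep E R k s t := by
  obtain ⟨l, r, ⟨l, r, hlr, τ, -, heq⟩ | hlr, C, σ, rfl, rfl⟩ := h
  · obtain ⟨rfl, rfl⟩ := Prod.mk.inj heq
    rw [subst_subst, subst_subst]
    exact ⟨_, .equation hlr C _⟩
  · exact ⟨_, .rule hlr C σ⟩

theorem convIn_of_rew_symm {W : Set (L.Term V)} {A : Set (L.Term V × L.Term V)} {s t : L.Term V}
    (hs : s ∈ W) (ht : t ∈ W) (h : Rew (symm A) s t) : ConvIn W A s t := by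
  rcases rew_symm h with h | h
  · exact .rel _ _ ⟨hs, ht, h⟩
  · exact .symm _ _ (.rel _ _ ⟨ht, hs, h⟩)

/-- An equation step between `a` and `b` has a persistent conversion within `W` if decreasing steps
from terms of `W` that are at most `a` or at most `b` have one. -/
theorem IsRun.convIn_equation (hgt : IsReductionOrder gt) (hrun : IsRun gt E R)
    {W : Set (L.Term V)} (hW : ∀ x ∈ W, ∀ y, gt x y → y ∈ W) (a b : L.Term V)
    (ha : a ∈ W) (hb : b ∈ W)
    (H : ∀ x, (x = a ∨ gt a x ∨ x = b ∨ gt b x) → ∀ k y, gt x y →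
      WeightedStep (allOf E) (allOf R) k x y → ConvIn W (persistent E ∪ persistent R) x y)
    (l r : L.Term V) (hlr : (l, r) ∈ symm (allOf E)) (C : Ctx L V) (σ : V → L.Term V)
    (hal : a = C.plug (l.subst σ)) (hbr : b = C.plug (r.subst σ)) :
    ConvIn W (persistent E ∪ persistent R) a b := by
  have hR := hrun.decreasing hgt
  induction hp : (a, b) using (hgt.wf.prod_gameAdd hgt.wf).induction generalizing a b l r with
  | _ p ih =>
  subst hp
  rcases hrun.equation_cases_symm hlr with h | ⟨-, h⟩ | ⟨-, h⟩ | h | ⟨u, h, h'⟩ | ⟨u, h, h'⟩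
  · exact convIn_of_rew_symm ha hb ⟨l, r, symm_mono Set.subset_union_left h, C, σ, hal, hbr⟩
  · exact H a (.inl rfl) (2 * encRank l) b
      (hal ▸ hbr ▸ hgt.ctx _ _ _ (hgt.subst _ _ _ (hR _ _ h))) (hal ▸ hbr ▸ .rule h C σ)
  · exact .symm _ _ (H b (.inr (.inr (.inl rfl))) (2 * encRank r) a
      (hal ▸ hbr ▸ hgt.ctx _ _ _ (hgt.subst _ _ _ (hR _ _ h))) (hal ▸ hbr ▸ .rule h C σ))
  · subst h
    rw [hal, hbr]
    exact .refl _
  · obtain ⟨hlu, k, -, hk⟩ := h.weightedStep hgt hR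
    have hau : gt a (C.plug (u.subst σ)) := hal ▸ hgt.ctx _ _ _ (hgt.subst _ _ _ hlu)
    refine .trans _ _ _ (H a (.inl rfl) k _ hau (hal ▸ hk.plug_subst C σ)) ?_
    refine ih (_, b) (.fst hau) _ b (hW a ha _ hau) hb ?_ u r h' rfl hbr rfl
    rintro x (rfl | hx | hx)
    · exact H _ (.inr (.inl hau))
    · exact H _ (.inr (.inl (hgt.trans _ _ _ hau hx)))
    · exact H _ (.inr (.inr hx))
  · obtain ⟨hru, k, -, hk⟩ := h.weightedStep hgt hR
    have hbu : gt b (C.plug (u.subst σ)) := hbr ▸ hgt.ctx _ _ _ (hgt.subst _ _ _ hru)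
    refine .trans _ _ _ ?_
      (.symm _ _ (H b (.inr (.inr (.inl rfl))) k _ hbu (hbr ▸ hk.plug_subst C σ)))
    refine ih (a, _) (.snd hbu) a _ ha (hW b hb _ hbu) ?_ l u h' hal rfl rfl
    rintro x (hx | hx | rfl | hx)
    · exact H _ (.inl hx)
    · exact H _ (.inr (.inl hx))
    · exact H _ (.inr (.inr (.inr hbu)))
    · exact H _ (.inr (.inr (.inr (hgt.trans _ _ _ hbu hx))))

/-- Decreasing steps have persistent conversions that stay within a given downward closed set: a
removed equation or rule is replaced by steps that are smaller with respect to the starting term,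
the weight and the final term, compared lexicographically. -/
theorem IsRun.convIn_of_gt (hgt : IsReductionOrder gt) (hrun : IsRun gt E R)
    {W : Set (L.Term V)} (hW : ∀ x ∈ W, ∀ y, gt x y → y ∈ W) (a : L.Term V) (ha : a ∈ W)
    (k : ℕ) (b : L.Term V) (hab : gt a b) (h : WeightedStep (allOf E) (allOf R) k a b) :
    ConvIn W (persistent E ∪ persistent R) a b := by
  have hR := hrun.decreasing hgt
  induction a using hgt.wf.induction generalizing k b with
  | _ a ihA =>
  induction k using Nat.strong_induction_on generalizing b with
  | _ k ihK =>
  induction b using hgt.wf.induction with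
  | _ b ihB =>
  have hbW := hW a ha b hab
  -- equation steps between terms below `a`
  have below : ∀ x y l r : L.Term V, gt a x → gt a y → (l, r) ∈ symm (allOf E) →
      ∀ (C : Ctx L V) (σ : V → L.Term V), x = C.plug (l.subst σ) → y = C.plug (r.subst σ) →
        ConvIn W (persistent E ∪ persistent R) x y := by
    intro x y l r hx hy hlr C σ hxl hyr
    refine hrun.convIn_equation hgt hW x y (hW a ha x hx) (hW a ha y hy) ?_ l r hlr C σ hxl hyr
    intro z hz k y hzy hstep
    have haz : gt a z := by
      rcases hz with rfl | hz | rfl | hz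
      · exact hx
      · exact hgt.trans _ _ _ hx hz
      · exact hy
      · exact hgt.trans _ _ _ hy hz
    exact ihA z haz (hW a ha z haz) k y hzy hstep
  cases h with
  | @rule l r hlr C σ =>
    rcases hrun.rule_cases hlr with h | ⟨u, h, h'⟩ | ⟨u, h, h'⟩
    · exact .rel _ _ ⟨ha, hbW, l, r, .inr h, C, σ, rfl, rfl⟩
    · obtain ⟨k, hk⟩ := exists_weightedStep h
      have hbu := hgt.ctx C _ _ (hgt.subst σ _ _ (hR.ordSystem.gt_of_rew hgt h))
      have hau := hgt.trans _ _ _ hab hbu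
      exact .trans _ _ _ (ihB _ hbu hau (.rule h' C σ))
        (.symm _ _ (ihA _ hab hbW _ _ hbu (hk.plug_subst C σ)))
    · obtain ⟨hlu, k, hlt, hk⟩ := h.weightedStep hgt hR
      have hau := hgt.ctx C _ _ (hgt.subst σ _ _ hlu)
      exact .trans _ _ _ (ihK k hlt _ hau (hk.plug_subst C σ))
        (below _ _ u r hau hab (.inl h') C σ rfl rfl)
  | @equation l r hlr C σ =>
    rcases hrun.equation_cases_symm hlr with h | ⟨-, h⟩ | ⟨h, -⟩ | h | ⟨u, h, h'⟩ | ⟨u, h, h'⟩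
    · exact convIn_of_rew_symm ha hbW ⟨l, r, symm_mono Set.subset_union_left h, C, σ, rfl, rfl⟩
    · exact ihK _ (Nat.lt_succ_self _) _ hab (.rule h C σ)
    · exact absurd (hgt.ctx C _ _ (hgt.subst σ _ _ h)) (hgt.asymm hab)
    · exact absurd (h ▸ hab) (hgt.irrefl _)
    · obtain ⟨hlu, k, hlt, hk⟩ := h.weightedStep hgt hR
      have hau := hgt.ctx C _ _ (hgt.subst σ _ _ hlu)
      exact .trans _ _ _ (ihK k hlt _ hau (hk.plug_subst C σ))
        (below _ _ u r hau hab h' C σ rfl rfl)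
    · obtain ⟨hru, k, -, hk⟩ := h.weightedStep hgt hR
      have hbu := hgt.ctx C _ _ (hgt.subst σ _ _ hru)
      have hau := hgt.trans _ _ _ hab hbu
      exact .trans _ _ _ (ihB _ hbu hau (.equation h' C σ))
        (.symm _ _ (ihA _ hab hbW _ _ hbu (hk.plug_subst C σ)))

/-- A step with an equation that occurs in the run has a persistent conversion within any downward
closed set containing its two terms. -/
theorem IsRun.convIn_of_rew (hgt : IsReductionOrder gt) (hrun : IsRun gt E R)
    {W : Set (L.Term V)} (hW : ∀ x ∈ W, ∀ y, gt x y → y ∈ W) {a b : L.Term V} (ha : a ∈ W)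
    (hb : b ∈ W) (h : Rew (allOf E) a b) : ConvIn W (persistent E ∪ persistent R) a b := by
  obtain ⟨l, r, hlr, C, σ, hal, hbr⟩ := h
  refine hrun.convIn_equation hgt hW a b ha hb ?_ l r (.inl hlr) C σ hal hbr
  intro x hx k y hxy hstep
  refine hrun.convIn_of_gt hgt hW x ?_ k y hxy hstep
  rcases hx with rfl | hx | rfl | hx
  · exact ha
  · exact hW _ ha _ hx
  · exact hb
  · exact hW _ hb _ hx

/-- The initial equations and the persistent equations and rules have the same conversions. -/
theorem IsRun.conversion_iff (hgt : IsReductionOrder gt) (hrun : IsRun gt E R) (s t : L.Term V) :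
    Conversion (E 0) s t ↔ Conversion (persistent E ∪ persistent R) s t := by
  constructor
  · refine fun h => h.of_conversion fun a b hab => ?_
    have := hrun.convIn_of_rew hgt (W := Set.univ) (fun _ _ _ _ => trivial) trivial trivial
      (Rew.of_mem (subset_allOf E 0 hab))
    exact eqvGen_lift id (fun _ _ h => .rel _ _ h.2.2) this
  · refine fun h => h.of_conversion fun a b hab => ?_
    rcases hab with hab | hab
    · obtain ⟨i, hi⟩ := Set.mem_iUnion.1 (persistent_subset_allOf _ hab)
      exact hrun.sound i a b (.inl hi)
    · obtain ⟨i, hi⟩ := Set.mem_iUnion.1 (persistent_subset_allOf _ hab)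
      exact hrun.sound i a b (.inr hi)

end

section

/-! ### Ground terms -/

theorem IsGround.subst_eq {t : L.Term V} (h : IsGround t) (σ : V → L.Term V) : t.subst σ = t :=
  subst_eq_self fun x hx => by simp_all [IsGround]

theorem isGround_subst {γ : V → L.Term V} (hγ : ∀ x, IsGround (γ x)) (t : L.Term V) :
    IsGround (t.subst γ) := by
  refine Set.eq_empty_of_forall_notMem fun x hx => ?_
  obtain ⟨y, -, hy⟩ := mem_vars_subst.1 hx
  simp_all [IsGround]

theorem vars_subset_plug (C : Ctx L V) (t : L.Term V) : vars t ⊆ vars (C.plug t) := by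
  induction C with
  | hole => exact subset_rfl
  | app f ts i C ih => exact fun x hx => mem_vars_func.2 ⟨i, by simpa using ih hx⟩

theorem IsGround.of_plug {C : Ctx L V} {t : L.Term V} (h : IsGround (C.plug t)) :
    IsGround t :=
  Set.subset_eq_empty (vars_subset_plug C t) h

theorem plug_subst_congr {C : Ctx L V} {u : L.Term V} {σ τ : V → L.Term V}
    (h : ∀ x ∈ vars (C.plug u), σ x = τ x) (t : L.Term V) :
    (C.subst σ).plug t = (C.subst τ).plug t := by
  induction C with
  | hole => rfl
  | app f ts i C ih =>
    simp only [Ctx.subst, Ctx.plug, mem_vars_func] at h ⊢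
    congr 1
    funext j
    by_cases hj : j = i
    · subst hj
      simpa using ih fun x hx => h x ⟨j, by simpa using hx⟩
    · simp only [Function.update_of_ne hj]
      exact subst_congr fun x hx => h x ⟨j, by simpa [hj] using hx⟩

variable {gt : L.Term V → L.Term V → Prop} {E R : Set (L.Term V × L.Term V)}

theorem ConvIn.map {W W' : Set (L.Term V)} {A : Set (L.Term V × L.Term V)}
    (C : Ctx L V) (σ : V → L.Term V) (hW : ∀ x ∈ W, C.plug (x.subst σ) ∈ W') {s t : L.Term V}
    (h : ConvIn W A s t) : ConvIn W' A (C.plug (s.subst σ)) (C.plug (t.subst σ)) :=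
  eqvGen_lift (fun t : L.Term V => C.plug (t.subst σ))
    (fun _ _ h => .rel _ _ ⟨hW _ h.1, hW _ h.2.1, (h.2.2.subst σ).plug C⟩) h

theorem ConvIn.plug (hgt : IsReductionOrder gt) {c : L.Term V} {A : Set (L.Term V × L.Term V)}
    (C : Ctx L V) {s t : L.Term V} (h : ConvIn {x | gt c x} A s t) :
    ConvIn {x | gt (C.plug c) x} A (C.plug s) (C.plug t) := by
  simpa only [subst_var] using
    h.map C Term.var fun x (hx : gt c x) => by simpa [subst_var] using hgt.ctx C _ _ hx

theorem convIn_of_reflTransGen (hgt : IsReductionOrder gt) {A : Set (L.Term V × L.Term V)}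
    (hA : Decreasing gt A) {c s t : L.Term V} (hs : gt c s) (h : ReflTransGen (Rew A) s t) :
    gt c t ∧ ConvIn {x | gt c x} A s t := by
  induction h with
  | refl => exact ⟨hs, .refl _⟩
  | tail _ h ih =>
    have := hgt.trans _ _ _ ih.1 (hA.gt_of_rew hgt h)
    exact ⟨this, .trans _ _ _ ih.2 (.rel _ _ ⟨ih.1, this, h⟩)⟩

theorem convIn_of_joinable (hgt : IsReductionOrder gt) {A : Set (L.Term V × L.Term V)}
    (hA : Decreasing gt A) {c s t : L.Term V} (hs : gt c s) (ht : gt c t) (h : Joinable A s t) :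
    ConvIn {x | gt c x} A s t := by
  obtain ⟨u, hsu, htu⟩ := h
  exact .trans _ _ _ (convIn_of_reflTransGen hgt hA hs hsu).2
    (.symm _ _ (convIn_of_reflTransGen hgt hA ht htu).2)

/-- By ground totality, every ground equation step can be oriented. -/
theorem convIn_ordSystem_of_rew (hgt : IsReductionOrder gt) (htotal : GroundTotal gt)
    (hR : Decreasing gt R) {W : Set (L.Term V)} {s t : L.Term V} (hs : s ∈ W) (ht : t ∈ W)
    {l r : L.Term V} (hlr : (l, r) ∈ symm (E ∪ R)) (C : Ctx L V) (σ : V → L.Term V)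
    (hsl : s = C.plug (l.subst σ)) (htr : t = C.plug (r.subst σ))
    (hgs : IsGround s) (hgt' : IsGround t) : ConvIn W (ordSystem gt E R) s t := by
  rcases htotal (l.subst σ) (r.subst σ) (.of_plug (hsl ▸ hgs)) (.of_plug (htr ▸ hgt'))
    with h | h | h
  · exact .rel _ _ ⟨hs, ht, (rew_ordSystem_iff hgt hR).2 ⟨l, r, hlr, C, σ, hsl, htr, h⟩⟩
  · exact .symm _ _ (.rel _ _ ⟨ht, hs, (rew_ordSystem_iff hgt hR).2
      ⟨r, l, mem_symm_swap hlr, C, σ, htr, hsl, h⟩⟩)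
  · rw [hsl, htr, h]
    exact .refl _

theorem convIn_ordSystem_of_convIn (hgt : IsReductionOrder gt) (htotal : GroundTotal gt)
    (hR : Decreasing gt R) {c s t : L.Term V} (hc : IsGround c) (hs : IsGround s)
    (ht : IsGround t) (h : ConvIn {x | gt c x} (E ∪ R) s t) :
    ConvIn {x | gt c x} (ordSystem gt E R) s t := by
  rw [← hs.subst_eq fun _ => c, ← ht.subst_eq fun _ => c]
  have hW : ∀ x, gt c x → gt c (x.subst fun _ => c) := fun x hx => by
    simpa only [hc.subst_eq] using hgt.subst (fun _ => c) _ _ hx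
  refine eqvGen_lift (fun t => t.subst fun _ => c) ?_ h
  rintro x y ⟨hx, hy, hxy⟩
  obtain ⟨l, r, hlr, C, σ, h₁, h₂⟩ := hxy.subst fun _ => c
  exact convIn_ordSystem_of_rew hgt htotal hR (hW x hx) (hW y hy) (.inl hlr) C σ h₁ h₂
    (isGround_subst (fun _ => hc) x) (isGround_subst (fun _ => hc) y)

/-! ### Peaks -/

/-- A subterm of an instance `lσ` is either an instance of a non-variable subterm of `l`, or a
subterm of some `σ x`. In the second case, a step in that subterm can be completed to a rewrite
sequence reaching a different instance of `l`. -/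
theorem subst_eq_plug {l : L.Term V} {σ : V → L.Term V} {C : Ctx L V} {s : L.Term V}
    (h : l.subst σ = C.plug s) :
    (∃ (D : Ctx L V) (u : L.Term V), ¬ IsVar u ∧ l = D.plug u ∧ u.subst σ = s ∧
      ∀ t, C.plug t = (D.subst σ).plug t) ∨
    ∃ τ : L.Term V → V → L.Term V, ∀ (A : Set (L.Term V × L.Term V)) (t : L.Term V), Rew A s t →
      (∀ x, ReflTransGen (Rew A) (σ x) (τ t x)) ∧
        ReflTransGen (Rew A) (C.plug t) (l.subst (τ t)) := by
  classical
  induction C generalizing l with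
  | hole =>
    cases l with
    | var x =>
      refine .inr ⟨fun t => Function.update σ x t, fun A t hst => ⟨fun y => ?_, ?_⟩⟩
      · by_cases hy : y = x
        · subst hy
          simp only [Term.subst, Ctx.plug] at h
          simpa [h] using ReflTransGen.single hst
        · simp only [Function.update_of_ne hy]
          exact .refl
      · simp only [Term.subst, Ctx.plug, Function.update_self]
        exact .refl
    | func f ls =>
      exact .inl ⟨.hole, Term.func f ls, fun ⟨x, hx⟩ => (by cases hx), rfl, h, fun t => rfl⟩
  | app f ts i C ih =>
    cases l with
    | var x =>
      refine .inr ⟨fun t => Function.update σ x ((Ctx.app f ts i C).plug t),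
        fun A t hst => ⟨fun y => ?_, ?_⟩⟩
      · by_cases hy : y = x
        · subst hy
          rw [Term.subst] at h
          simpa [h] using ReflTransGen.single (hst.plug (.app f ts i C))
        · simp only [Function.update_of_ne hy]
          exact .refl
      · simp only [Term.subst, Function.update_self]
        exact .refl
    | func g ls =>
      simp only [Term.subst, Ctx.plug, Term.func.injEq] at h
      obtain ⟨rfl, hfg, h⟩ := h
      obtain rfl := eq_of_heq hfg
      rw [heq_eq_eq, funext_iff] at h
      have hi : (ls i).subst σ = C.plug s := by simpa using h i
      have hne : ∀ j ≠ i, ts j = (ls j).subst σ := fun j hj => by simp [h j, hj]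
      rcases ih hi with ⟨D, u, hu, hl, hs, hD⟩ | ⟨τ, hτ⟩
      · refine .inl ⟨.app g ls i D, u, hu, by simp [Ctx.plug, ← hl], hs, fun t => ?_⟩
        simp only [Ctx.plug, Ctx.subst, hD]
        congr 1
        funext j
        by_cases hj : j = i
        · subst hj; simp
        · simp [hj, hne]
      · refine .inr ⟨τ, fun A t hst => ⟨(hτ A t hst).1, ?_⟩⟩
        refine reflTransGen_func g fun j => ?_
        by_cases hj : j = i
        · subst hj
          simpa using (hτ A t hst).2
        · rw [Function.update_of_ne hj, hne j hj]
          exact reflTransGen_subst_pointwise (hτ A t hst).1 _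

theorem mem_symm_relabel {A : Set (L.Term V × L.Term V)} {l r : L.Term V} {π : Equiv.Perm V}
    (h : (l, r) ∈ symm A) : VariantIn (symm A) (l.relabel π) (r.relabel π) :=
  ⟨π.symm, by simpa using h⟩

/-- A critical peak whose inner redex has only normal forms as proper subterms is an instance of
an extended prime critical pair. -/
theorem exists_extPCP [Infinite V] (hgt : IsReductionOrder gt) (hR : Decreasing gt R)
    {l₁ r₁ l₂ r₂ u : L.Term V} {D : Ctx L V} {σ₁ σ₂ : V → L.Term V}
    (h₁ : (l₁, r₁) ∈ symm (E ∪ R)) (h₂ : (l₂, r₂) ∈ symm (E ∪ R)) (hu : ¬ IsVar u)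
    (hl₂ : l₂ = D.plug u) (heq : u.subst σ₂ = l₁.subst σ₁)
    (hgt₁ : gt (l₁.subst σ₁) (r₁.subst σ₁)) (hgt₂ : gt (l₂.subst σ₂) (r₂.subst σ₂))
    (hnf : ∀ s, ProperSubterm s (l₁.subst σ₁) → NormalForm (Rew (ordSystem gt E R)) s) :
    ∃ s t : L.Term V, (s, t) ∈ extPCP gt (E ∪ R) ∧ ∃ ρ : V → L.Term V,
      (D.subst σ₂).plug (r₁.subst σ₁) = s.subst ρ ∧ r₂.subst σ₂ = t.subst ρ := by
  classical
  have hB := (finite_vars l₂).union (finite_vars r₂)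
  obtain ⟨π, hπ⟩ := exists_perm_disjoint ((finite_vars l₁).union (finite_vars r₁)) hB
  -- the common instantiation of the second equation and the renamed first one
  let θ : V → L.Term V := fun x => if x ∈ vars l₂ ∪ vars r₂ then σ₂ x else σ₁ (π.symm x)
  have hθ₂ : ∀ t : L.Term V, vars t ⊆ vars l₂ ∪ vars r₂ → t.subst θ = t.subst σ₂ := fun t ht =>
    subst_congr fun x hx => if_pos (ht hx)
  have hθ₁ : ∀ t : L.Term V, vars t ⊆ vars l₁ ∪ vars r₁ →
      (t.relabel π).subst θ = t.subst σ₁ := fun t ht => by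
    rw [relabel_eq_subst, subst_subst]
    refine subst_congr fun x hx => ?_
    simp only [Term.subst, θ, if_neg (hπ x (ht hx)), Equiv.symm_apply_apply]
  have hvu : vars u ⊆ vars l₂ := hl₂ ▸ vars_subset_plug D u
  have hl₁θ := hθ₁ l₁ Set.subset_union_left
  have hr₁θ := hθ₁ r₁ Set.subset_union_right
  have hl₂θ := hθ₂ l₂ Set.subset_union_left
  have hr₂θ := hθ₂ r₂ Set.subset_union_right
  have hunif : (l₁.relabel π).subst θ = u.subst θ := by
    rw [hl₁θ, hθ₂ u (hvu.trans Set.subset_union_left), heq]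
  obtain ⟨μ, hμ⟩ := exists_isMGU _ _ θ hunif
  obtain ⟨ρ, hρ⟩ := hμ.2 θ hunif
  have hμρ : ∀ t : L.Term V, (t.subst μ).subst ρ = t.subst θ := fun t => by
    rw [subst_subst, ← funext hρ]
  refine ⟨_, _, ⟨l₁.relabel π, r₁.relabel π, D, u, l₂, r₂, μ, ⟨mem_symm_relabel h₁, ?_, ?_, hl₂,
    hu, hμ, ?_, ?_⟩, ?_, rfl⟩, ρ, ?_, ?_⟩
  · exact ⟨1, by simpa [relabel_eq_subst, subst_var] using h₂⟩
  · rw [Set.disjoint_left]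
    intro x hx
    simp only [relabel_eq_subst, Set.mem_union, mem_vars_subst, mem_vars_var] at hx
    rcases hx with ⟨y, hy, rfl⟩ | ⟨y, hy, rfl⟩
    · exact hπ y (.inl hy)
    · exact hπ y (.inr hy)
  · intro h
    have := hgt.subst ρ _ _ h
    rw [hμρ, hμρ, hl₁θ, hr₁θ] at this
    exact hgt.asymm this hgt₁
  · intro h
    have := hgt.subst ρ _ _ h
    rw [hμρ, hμρ, hl₂θ, hr₂θ] at this
    exact hgt.asymm this hgt₂
  · intro s hs t hst
    have hs' := hs.subst ρ
    rw [hμρ, hl₁θ] at hs'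
    exact hnf _ hs' _ ((rew_ordSystem_of_rew_ordInst hgt hR hst).subst ρ)
  · rw [hμρ, subst_plug, hr₁θ]
    refine plug_subst_congr (u := u) (fun x hx => ?_) _
    rw [← hl₂] at hx
    exact (if_pos (Or.inl hx)).symm
  · rw [hμρ, hr₂θ]

/-! ### Abstract confluence and minimal subterms -/

/-- Abstract confluence criterion: a terminating relation is confluent if the two ends of every
local peak are connected by a conversion below its source. -/
theorem join_of_connected_below {α : Type*} {r gt : α → α → Prop}
    (wf : WellFounded fun b a => gt a b) (hr : ∀ a b, r a b → gt a b)
    (h : ∀ c a b, r c a → r c b → EqvGen (fun x y => gt c x ∧ gt c y ∧ r x y) a b)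
    (c a b : α) (ha : ReflTransGen r c a) (hb : ReflTransGen r c b) :
    Join (ReflTransGen r) a b := by
  induction c using wf.induction generalizing a b with
  | _ c ih =>
  have key : ∀ x y, EqvGen (fun x y => gt c x ∧ gt c y ∧ r x y) x y →
      x = y ∨ (gt c x ∧ gt c y ∧ Join (ReflTransGen r) x y) := by
    intro x y hxy
    induction hxy with
    | rel x y h => exact .inr ⟨h.1, h.2.1, y, .single h.2.2, .refl⟩
    | refl x => exact .inl rfl
    | symm x y _ ih =>
      rcases ih with ih | ⟨hx, hy, u, hxu, hyu⟩
      · exact .inl ih.symm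
      · exact .inr ⟨hy, hx, u, hyu, hxu⟩
    | trans x y z _ _ ih₁ ih₂ =>
      rcases ih₁ with rfl | ⟨hx, hy, u, hxu, hyu⟩
      · exact ih₂
      rcases ih₂ with rfl | ⟨-, hz, v, hyv, hzv⟩
      · exact .inr ⟨hx, hy, u, hxu, hyu⟩
      obtain ⟨w, huw, hvw⟩ := ih y hy u v hyu hyv
      exact .inr ⟨hx, hz, w, hxu.trans huw, hzv.trans hvw⟩
  rcases ha.cases_head with rfl | ⟨a', hca, ha⟩
  · exact ⟨b, hb, .refl⟩
  rcases hb.cases_head with rfl | ⟨b', hcb, hb⟩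
  · exact ⟨a, .refl, ha.head hca⟩
  obtain ⟨u, hau, hbu⟩ : Join (ReflTransGen r) a' b' := by
    rcases key a' b' (h c a' b' hca hcb) with rfl | h
    · exact ⟨a', .refl, .refl⟩
    · exact h.2.2
  obtain ⟨v, hav, huv⟩ := ih a' (hr _ _ hca) a u ha hau
  obtain ⟨w, hvw, hbw⟩ := ih b' (hr _ _ hcb) v b (hbu.trans huv) hb
  exact ⟨w, hav.trans hvw, hbw⟩

/-- A term with a property has a minimal subterm (possibly itself) with that property. It is applied
to reducibility, where it yields an innermost redex. -/
theorem exists_minimal_subterm {P : L.Term V → Prop} (t : L.Term V) (h : P t) :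
    ∃ (C : Ctx L V) (s : L.Term V), t = C.plug s ∧ P s ∧
      ∀ s', ProperSubterm s' s → ¬ P s' := by
  induction hn : tsize t using Nat.strong_induction_on generalizing t with
  | _ n ih =>
  by_cases hsub : ∃ s, ProperSubterm s t ∧ P s
  · obtain ⟨s, hs, hPs⟩ := hsub
    obtain ⟨C, s', rfl, h'⟩ := ih _ (hn ▸ hs.tsize_lt) s hPs rfl
    obtain ⟨D, -, rfl⟩ := hs
    exact ⟨D.comp C, s', (plug_comp ..).symm, h'⟩
  · exact ⟨.hole, t, rfl, h, fun s hs hPs => hsub ⟨s, hs, hPs⟩⟩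

end

section

variable {gt : L.Term V → L.Term V → Prop} {E R : ℕ → Set (L.Term V × L.Term V)}

/-! ### Ground confluence -/

/-- `RootStep gt A s t`: a decreasing step at the root from `s` to `t` by an equation of `A` or its
reversal. -/
def RootStep (gt : L.Term V → L.Term V → Prop) (A : Set (L.Term V × L.Term V))
    (s t : L.Term V) : Prop :=
  ∃ l r : L.Term V, (l, r) ∈ symm A ∧ ∃ σ : V → L.Term V,
    s = l.subst σ ∧ t = r.subst σ ∧ gt s t

theorem rew_ordSystem_iff_rootStep (hgt : IsReductionOrder gt) {E R : Set (L.Term V × L.Term V)}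
    (hR : Decreasing gt R) {s t : L.Term V} :
    Rew (ordSystem gt E R) s t ↔ ∃ (C : Ctx L V) (s' t' : L.Term V),
      s = C.plug s' ∧ t = C.plug t' ∧ RootStep gt (E ∪ R) s' t' := by
  rw [rew_ordSystem_iff hgt hR]
  constructor
  · rintro ⟨l, r, hlr, C, σ, hs, ht, h⟩
    exact ⟨C, _, _, hs, ht, l, r, hlr, σ, rfl, rfl, h⟩
  · rintro ⟨C, s', t', hs, ht, l, r, hlr, σ, rfl, rfl, h⟩
    exact ⟨l, r, hlr, C, σ, hs, ht, h⟩

theorem RootStep.subst (hgt : IsReductionOrder gt) {A : Set (L.Term V × L.Term V)}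
    {s t : L.Term V} (h : RootStep gt A s t) (σ : V → L.Term V) :
    RootStep gt A (s.subst σ) (t.subst σ) := by
  obtain ⟨l, r, hlr, τ, rfl, rfl, h⟩ := h
  exact ⟨l, r, hlr, fun x => (τ x).subst σ, subst_subst .., subst_subst .., hgt.subst _ _ _ h⟩

theorem RootStep.rew (hgt : IsReductionOrder gt) {E R : Set (L.Term V × L.Term V)}
    (hR : Decreasing gt R) {s t : L.Term V} (h : RootStep gt (E ∪ R) s t) :
    Rew (ordSystem gt E R) s t :=
  (rew_ordSystem_iff_rootStep hgt hR).2 ⟨.hole, s, t, rfl, rfl, h⟩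

/-- A ground peak between a root step and a step at a redex whose proper subterms are
normal forms is connected below its source. -/
theorem IsRun.convIn_of_root_peak [Infinite V] (hgt : IsReductionOrder gt)
    (htotal : GroundTotal gt) (hrun : IsRun gt E R) (hfair : IsFair gt E R)
    {c s t b : L.Term V} {C : Ctx L V} (hst : RootStep gt (persistent E ∪ persistent R) s t)
    (hnf : ∀ s', ProperSubterm s' s →
      NormalForm (Rew (ordSystem gt (persistent E) (persistent R))) s')
    (hcb : RootStep gt (persistent E ∪ persistent R) c b) (hcs : c = C.plug s)
    (hc : IsGround c) (ha : IsGround (C.plug t)) (hb : IsGround b) :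
    ConvIn {x | gt c x} (ordSystem gt (persistent E) (persistent R)) (C.plug t) b := by
  have hR := hrun.decreasing_persistent hgt
  have hS := hR.ordSystem (E := persistent E)
  have hca : gt c (C.plug t) := hcs ▸ hgt.ctx C _ _ (hS.gt_of_rew hgt (hst.rew hgt hR))
  have hrew := hst.rew hgt hR
  obtain ⟨l₁, r₁, h₁, σ₁, rfl, rfl, hgt₁⟩ := hst
  obtain ⟨l₂, r₂, h₂, σ₂, rfl, rfl, hgt₂⟩ := hcb
  rcases subst_eq_plug hcs with ⟨D, u, hu, hl₂, hs, hD⟩ | ⟨τ, hτ⟩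
  · obtain ⟨p, q, hpq, ρ, hp, hq⟩ := exists_extPCP hgt hR h₁ h₂ hu hl₂ hs hgt₁ hgt₂ hnf
    rw [hD, hp] at ha hca ⊢
    rw [hq] at hb hgt₂ ⊢
    have hW : ∀ x ∈ {x | gt (l₂.subst σ₂) x}, ∀ y, gt x y → y ∈ {x | gt (l₂.subst σ₂) x} :=
      fun x hx y hxy => hgt.trans _ _ _ hx hxy
    rcases hfair p q hpq with ⟨z, hz₁, hz₂⟩ | h | h
    · exact convIn_of_joinable hgt hS hca hgt₂
        ⟨_, reflTransGen_subst hz₁ ρ, reflTransGen_subst hz₂ ρ⟩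
    · exact convIn_ordSystem_of_convIn hgt htotal hR hc ha hb
        (hrun.convIn_of_rew hgt hW hca hgt₂ (h.subst ρ))
    · exact convIn_ordSystem_of_convIn hgt htotal hR hc ha hb
        (.symm _ _ (hrun.convIn_of_rew hgt hW hgt₂ hca (h.subst ρ)))
  · obtain ⟨h, hl⟩ := hτ _ _ hrew
    have hr := reflTransGen_subst_pointwise h r₂
    -- the reducts of both sides of the second equation are made ground
    set γ : V → L.Term V := fun _ => l₂.subst σ₂
    have hγ : ∀ x, IsGround (γ x) := fun _ => hc
    have hl' := reflTransGen_subst hl γ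
    have hr' := reflTransGen_subst hr γ
    rw [ha.subst_eq] at hl'
    rw [hb.subst_eq] at hr'
    obtain ⟨hl₁, hl₂⟩ := convIn_of_reflTransGen hgt hS hca hl'
    obtain ⟨hr₁, hr₂⟩ := convIn_of_reflTransGen hgt hS hgt₂ hr'
    refine .trans _ _ _ hl₂ (.trans _ _ _ ?_ (.symm _ _ hr₂))
    exact convIn_ordSystem_of_rew hgt htotal hR hl₁ hr₁ h₂ .hole
      (fun x => (τ (r₁.subst σ₁) x).subst γ) (subst_subst ..) (subst_subst ..)
      (isGround_subst hγ _) (isGround_subst hγ _)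

/-- A ground peak between a step at a redex whose proper subterms are normal forms and an arbitrary
step is connected below its source, by induction on the two contexts: steps in different arguments
commute, and otherwise one step is at the root. -/
theorem IsRun.convIn_of_minimal_peak [Infinite V] (hgt : IsReductionOrder gt)
    (htotal : GroundTotal gt) (hrun : IsRun gt E R) (hfair : IsFair gt E R)
    {c s t p q : L.Term V} {C D : Ctx L V}
    (hst : RootStep gt (persistent E ∪ persistent R) s t)
    (hnf : ∀ s', ProperSubterm s' s →
      NormalForm (Rew (ordSystem gt (persistent E) (persistent R))) s')
    (hpq : RootStep gt (persistent E ∪ persistent R) p q)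
    (hcs : c = C.plug s) (hcp : c = D.plug p)
    (hc : IsGround c) (ha : IsGround (C.plug t)) (hb : IsGround (D.plug q)) :
    ConvIn {x | gt c x} (ordSystem gt (persistent E) (persistent R)) (C.plug t) (D.plug q) := by
  have hR := hrun.decreasing_persistent hgt
  have hS := hR.ordSystem (E := persistent E)
  have hrew₁ := hst.rew hgt hR
  have hrew₂ := hpq.rew hgt hR
  induction C generalizing c D with
  | hole =>
    cases D with
    | hole =>
      exact hrun.convIn_of_root_peak (C := .hole) hgt htotal hfair hst hnf
        (by rwa [show p = c from hcp.symm] at hpq) hcs hc ha hb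
    | app g us j D =>
      exact absurd hrew₂ (hnf p ⟨_, by simp, hcs.symm.trans hcp⟩ q)
  | app f ts i C ih =>
    cases D with
    | hole =>
      exact hrun.convIn_of_root_peak hgt htotal hfair hst hnf
        (by rwa [show p = c from hcp.symm] at hpq) hcs hc ha hb
    | app g us j D =>
      have heq := hcs.symm.trans hcp
      simp only [Ctx.plug, Term.func.injEq] at heq
      obtain ⟨rfl, hfg, heq⟩ := heq
      obtain rfl := eq_of_heq hfg
      rw [heq_eq_eq, funext_iff] at heq
      by_cases hij : i = j
      · subst hij
        have hus : ∀ z, Function.update us i z = Function.update ts i z := fun z => by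
          funext k
          by_cases hk : k = i
          · subst hk; simp
          · simpa [hk] using (heq k).symm
        have hCD : C.plug s = D.plug p := by simpa using heq i
        simp only [Ctx.plug, hus] at hcs ha hb ⊢
        subst hcs
        exact (ih rfl hCD (.of_plug (C := .app f ts i .hole) hc)
          (.of_plug (C := .app f ts i .hole) ha)
          (.of_plug (C := .app f ts i .hole) hb)).plug hgt (.app f ts i .hole)
      · -- the two steps take place in different arguments
        have hi : us i = C.plug s := by simpa [hij] using (heq i).symm
        have hj : ts j = D.plug p := by simpa [Ne.symm hij] using heq j
        have hother : ∀ k, k ≠ i → k ≠ j → ts k = us k := fun k hki hkj => by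
          simpa [hki, hkj] using heq k
        have h₁ := hrew₁.plug (.app f (Function.update us j (D.plug q)) i C)
        have h₂ := hrew₂.plug (.app f (Function.update ts i (C.plug t)) j D)
        have hca := hS.gt_of_rew hgt (hrew₁.plug (.app f ts i C))
        have hcb := hS.gt_of_rew hgt (hrew₂.plug (.app f us j D))
        rw [← hcs] at hca
        rw [← hcp] at hcb
        refine convIn_of_joinable hgt hS hca hcb ⟨Term.func f (Function.update
          (Function.update us j (D.plug q)) i (C.plug t)), .single ?_, .single ?_⟩
        · simp only [Ctx.plug] at h₂ ⊢
          convert h₂ using 2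
          · rw [eq_comm, Function.update_eq_self_iff, Function.update_of_ne (Ne.symm hij), hj]
          · funext k
            by_cases hki : k = i
            · subst hki; simp [hij]
            · by_cases hkj : k = j
              · subst hkj; simp [hki]
              · simp [hki, hkj, hother k hki hkj]
        · simp only [Ctx.plug] at h₁ ⊢
          convert h₁ using 2
          rw [eq_comm, Function.update_eq_self_iff, Function.update_of_ne hij, hi]

/-- Every ground peak is connected below its source: reducing a minimal redex of the source splits
the peak into two peaks, each of which contains a step at a redex whose proper subterms are normal
forms. -/
theorem IsRun.convIn_of_peak [Infinite V] (hgt : IsReductionOrder gt)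
    (htotal : GroundTotal gt) (hrun : IsRun gt E R) (hfair : IsFair gt E R) {c a b : L.Term V}
    (hca : Rew (ordSystem gt (persistent E) (persistent R)) c a)
    (hcb : Rew (ordSystem gt (persistent E) (persistent R)) c b)
    (hc : IsGround c) (ha : IsGround a) (hb : IsGround b) :
    ConvIn {x | gt c x} (ordSystem gt (persistent E) (persistent R)) a b := by
  have hR := hrun.decreasing_persistent hgt
  obtain ⟨C, s, hcs, ⟨t, hst⟩, hmin⟩ := exists_minimal_subterm
    (P := fun s => ∃ t, Rew (ordSystem gt (persistent E) (persistent R)) s t) c ⟨a, hca⟩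
  have hnf : ∀ s', ProperSubterm s' s →
      NormalForm (Rew (ordSystem gt (persistent E) (persistent R))) s' :=
    fun s' hs' t ht => hmin s' hs' ⟨t, ht⟩
  obtain ⟨D, s', t', hs, -, hst⟩ := (rew_ordSystem_iff_rootStep hgt hR).1 hst
  -- the reduct of the minimal redex is made ground
  have hst' := hst.subst hgt fun _ => c
  rw [IsGround.subst_eq (IsGround.of_plug (hs ▸ IsGround.of_plug (hcs ▸ hc)))] at hst'
  obtain rfl : D = .hole := by
    by_contra hD
    exact hnf s' ⟨D, hD, hs⟩ _ (hst.rew hgt hR)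
  obtain rfl : s = s' := hs
  have hcs' : c = (C.subst fun _ => c).plug s := by
    have := congrArg (fun t => t.subst fun _ => c) hcs
    simpa only [hc.subst_eq, subst_plug,
      IsGround.subst_eq (IsGround.of_plug (hcs ▸ hc) : IsGround s)] using this
  have he : IsGround ((C.subst fun _ => c).plug (t'.subst fun _ => c)) := by
    rw [← subst_plug]
    exact isGround_subst (fun _ => hc) _
  have key : ∀ d, IsGround d → Rew (ordSystem gt (persistent E) (persistent R)) c d →
      ConvIn {x | gt c x} (ordSystem gt (persistent E) (persistent R))
        ((C.subst fun _ => c).plug (t'.subst fun _ => c)) d := by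
    intro d hd hcd
    obtain ⟨D, p, q, hcp, rfl, hpq⟩ := (rew_ordSystem_iff_rootStep hgt hR).1 hcd
    exact hrun.convIn_of_minimal_peak hgt htotal hfair hst' hnf hpq hcs' hcp hc he hd
  exact .trans _ _ _ (.symm _ _ (key a ha hca)) (key b hb hcb)

theorem IsRun.groundConfluent [Infinite V] (hgt : IsReductionOrder gt)
    (htotal : GroundTotal gt) (hrun : IsRun gt E R) (hfair : IsFair gt E R) :
    GroundConfluent (ordSystem gt (persistent E) (persistent R)) := by
  have hR := hrun.decreasing_persistent hgt
  have hS := hR.ordSystem (E := persistent E)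
  rintro s t hs ht ⟨c, hcs, hct⟩
  set S := ordSystem gt (persistent E) (persistent R)
  let r : L.Term V → L.Term V → Prop := fun x y => IsGround x ∧ IsGround y ∧ Rew S x y
  let γ : V → L.Term V := fun _ => s
  have hγ : ∀ x, IsGround (γ x) := fun _ => hs
  have ground : ∀ x y, Rew S x y → r (x.subst γ) (y.subst γ) := fun x y h =>
    ⟨isGround_subst hγ x, isGround_subst hγ y, h.subst γ⟩
  have hcs' : ReflTransGen r _ _ := hcs.lift (fun t => t.subst γ) fun x y h => ground x y h
  have hct' : ReflTransGen r _ _ := hct.lift (fun t => t.subst γ) fun x y h => ground x y h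
  simp only [hs.subst_eq, ht.subst_eq] at hcs' hct'
  obtain ⟨z, hsz, htz⟩ := join_of_connected_below hgt.wf
    (fun a b (h : r a b) => hS.gt_of_rew hgt h.2.2) (fun c a b hca hcb => by
      have := hrun.convIn_of_peak hgt htotal hfair hca.2.2 hcb.2.2 hca.1 hca.2.1 hcb.2.1
      have hmap := eqvGen_lift (q := fun x y => gt c x ∧ gt c y ∧ r x y) (fun t => t.subst γ)
        (fun x y h => .rel _ _ ⟨?_, ?_, ground x y h.2.2⟩) this
      · simpa only [hca.2.1.subst_eq, hcb.2.1.subst_eq] using hmap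
      · simpa only [hca.1.subst_eq] using hgt.subst γ _ _ h.1
      · simpa only [hca.1.subst_eq] using hgt.subst γ _ _ h.2.1) _ _ _ hcs' hct'
  exact ⟨z, hsz.lift id fun _ _ h => h.2.2, htz.lift id fun _ _ h => h.2.2⟩

end

end OrderedCompletion


theorem mainTheorem3 {L : FirstOrder.Language.{u, v}} {V : Type w} [Infinite V]
    (gt : L.Term V → L.Term V → Prop)
    (hgt : OrderedCompletion.IsReductionOrder gt)
    (htotal : OrderedCompletion.GroundTotal gt)
    (E R : ℕ → Set (L.Term V × L.Term V))
    (hrun : OrderedCompletion.IsRun gt E R)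
    (hfair : OrderedCompletion.IsFair gt E R) :
    OrderedCompletion.GroundComplete
        (OrderedCompletion.ordSystem gt
          (OrderedCompletion.persistent E) (OrderedCompletion.persistent R)) ∧
      ∀ s t : L.Term V,
        OrderedCompletion.Conversion (E 0) s t ↔
          OrderedCompletion.Conversion
            (OrderedCompletion.persistent E ∪ OrderedCompletion.persistent R) s t := by
  refine ⟨⟨?_, hrun.groundConfluent hgt htotal hfair⟩, hrun.conversion_iff hgt⟩
  exact Subrelation.wf (fun h => (hrun.decreasing_persistent hgt).ordSystem.gt_of_rew hgt h) hgt.wf
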